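/- **Setting.** Let $Q$ be the cyclic quiver with vertices $0,\dots,n-1$ (indices modulo $n$, $n\ge 1$) and arrows $a_i: i\to i+1$, and let $\alpha,\zeta\in\mathbb Z_{\ge 0}^n$ and $\lambda\in\mathbb C$. Put $V_q=\mathbb C^{\zeta_q}$, let $\mathcal A[t]$ be the space of entire functions, $M=\max_i\alpha_i$, and for every vertex $i$ let $$J(\lambda,\alpha)_i=\Big\{g\in\mathcal A[t]\otimes\bigoplus_qV_q\ :\ \big(\tfrac{d}{dt}-\lambda\big)^{M}g=0\Big\}.$$ The arrow $a_i:J(\lambda,\alpha)_i\to J(\lambda,\alpha)_{i+1}$ acts as $\frac{d}{dt}$ on the components in $V_i$ and as the identity on the other components. Let $\mathrm{Grass}_\alpha(J(\lambda,\alpha))$ be the quiver Grassmannian of tuples of subspaces $U_i\subseteq J(\lambda,\alpha)_i$ with $\dim U_i=\alpha_i$ and $a_i(U_i)\subseteq U_{i+1}$ for all $i$. Let $e_{q,r,s}$ ($0\le q<n$, $1\le r\le\zeta_q$, $0\le s<M$) be the vector function whose only nonzero component is the $r$-th one in $V_q$, equal to $\frac{t^s}{s!}e^{\lambda t}$; these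 form a basis of each $J(\lambda,\alpha)_i$. For $\omega=(\omega_i)_i$ with $[\omega_i]\in\mathbb P(\bigwedge^{\alpha_i}J(\lambda,\alpha)_i)$ let $p^{(i)}_{k_1\dots k_{\alpha_i}}$ be the coordinates of $\omega_i$ in this basis, where the $k_a=(q_a,r_a,s_a)$ are triples; they are alternating in the indices, and are $0$ if some $s_a\ge M$. Consider the following equations. (a) For every $i$, with $m=\alpha_i$ and $p=p^{(i)}$: (i) the Plücker equations; (ii) $p_{k_1\dots k_m}=0$ whenever $s_1\le\dots\le s_m$ and $s_j\ge j$ for some $1\le j\le m$; (iii) for all triples $k_1,\dots,k_m$, $\sum_{0\neq\epsilon\in\{0,1\}^m}p_{k_1+\epsilon_1,\dots,k_m+\epsilon_m}=0$, where $(q,r,s)+\epsilon=(q,r,s+\epsilon)$. (b) (for $\alpha$ constant) $p^{(i)}_{j_1\dots j_{\alpha_i}}p^{(i+1)}_{k_1\dots k_{\alpha_i}}=p^{(i)}_{k_1\dots k_{\alpha_i}}p^{(i+1)}_{j_1\dots j_{\alpha_i}}$ for all $i$ and all tuples $j$, $k$. (c) $\sum_{l=0}^{\alpha_{i+1}}(-1)^l\,p^{(i)}_{j_1\dots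 j_{\alpha_i-1}k_l'}\,p^{(i+1)}_{k_0\dots\widehat{k_l}\dots k_{\alpha_{i+1}}}=0$ for all $i$ with $\alpha_i\ge1$, all tuples of triples $j_1,\dots,j_{\alpha_i-1}$ with last entries less than $\alpha_i$ and all $k_0,\dots,k_{\alpha_{i+1}}$, where $(q,r,s)'=(q,r,s+1)$ if $q=i$ and $k'=k$ for the other triples. **Theorem.** The Grassmannian $\mathrm{Grass}_\alpha(J(\lambda,\alpha))$ is isomorphic, as an algebraic variety, to the following subvariety of $\prod_{i}\mathbb P\big(\bigwedge^{\alpha_i}J(\lambda,\alpha)_i\big)$. * If $\lambda\ne0$ and $\alpha$ is constant: the subvariety given by (a) and (b). An isomorphism sends $(U_i)$ to the Plücker points of the subspaces $(a_{i-1}\cdots a_1a_0)^{-1}(U_i)$. * If $\lambda\neq 0$ and $\alpha$ is not constant, the Grassmannian is empty. * If $\lambda=0$: the subvariety given by (a) and (c). An isomorphism sends $(U_i)$ to the Plücker points of the $U_i$. -/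

import Mathlib

open scoped BigOperators LinearAlgebra.Projectivization Topology

noncomputable section

namespace CyclicQuiver

/-! ### Entire functions and the module `J(λ, α)` -/

/-- The entire functions, as a subspace of all functions `ℂ → ℂ`. -/
def entireSubmodule : Submodule ℂ (ℂ → ℂ) where
  carrier := {f | Differentiable ℂ f}
  add_mem' hf hg := Differentiable.add hf hg
  zero_mem' := differentiable_const (0 : ℂ)
  smul_mem' c _ hf := Differentiable.const_smul hf c

/-- The space `𝒜[t]` of entire functions `ℂ → ℂ`. -/
def Entire : Type := entireSubmodule

instance : AddCommGroup Entire := inferInstanceAs (AddCommGroup entireSubmodule)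

instance : Module ℂ Entire := inferInstanceAs (Module ℂ entireSubmodule)

/-- An entire function as a function. -/
def Entire.toFun : Entire →ₗ[ℂ] (ℂ → ℂ) := entireSubmodule.subtype

/-- An entire function from a differentiable function. -/
def Entire.mk (f : ℂ → ℂ) (hf : Differentiable ℂ f) : Entire := (⟨f, hf⟩ : entireSubmodule)

theorem Entire.toFun_mk (f : ℂ → ℂ) (hf : Differentiable ℂ f) :
    Entire.toFun (Entire.mk f hf) = f := rfl

theorem Entire.differentiable (f : Entire) : Differentiable ℂ f.toFun := Subtype.property f

theorem Entire.ext {f g : Entire} (h : ∀ t, f.toFun t = g.toFun t) : f = g :=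
  Subtype.ext (funext h)

theorem differentiable_deriv {f : ℂ → ℂ} (hf : Differentiable ℂ f) :
    Differentiable ℂ (deriv f) := by
  rw [← differentiableOn_univ] at hf ⊢
  exact hf.deriv isOpen_univ

/-- Differentiation `d/dt` of entire functions. -/
def D : Module.End ℂ Entire where
  toFun f := Entire.mk (deriv f.toFun) (differentiable_deriv f.differentiable)
  map_add' f g := Entire.ext fun t => deriv_add (f.differentiable t) (g.differentiable t)
  map_smul' c f := Entire.ext fun t => deriv_const_smul c (f.differentiable t)

theorem D_toFun (f : Entire) (t : ℂ) : (D f).toFun t = deriv f.toFun t := rfl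

variable {n : ℕ}

/-- The pairs `(q, r)` with `q` a vertex and `1 ≤ r ≤ ζ_q`: they index the coordinates
of `⨁_q V_q`, where `dim V_q = ζ_q`. -/
abbrev Comp (ζ : Fin n → ℕ) : Type := Σ q : Fin n, Fin (ζ q)

/-- `𝒜[t] ⊗ ⨁_q V_q`: vector functions with entire coordinates. -/
def VecFun (ζ : Fin n → ℕ) : Type := Comp ζ → Entire

instance (ζ : Fin n → ℕ) : AddCommGroup (VecFun ζ) :=
  inferInstanceAs (AddCommGroup (Comp ζ → Entire))

instance (ζ : Fin n → ℕ) : Module ℂ (VecFun ζ) :=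
  inferInstanceAs (Module ℂ (Comp ζ → Entire))

/-- The component of a vector function with index `c = (q, r)`. -/
def comp (ζ : Fin n → ℕ) (c : Comp ζ) : VecFun ζ →ₗ[ℂ] Entire :=
  (LinearMap.proj c : (Comp ζ → Entire) →ₗ[ℂ] Entire)

theorem VecFun.ext {ζ : Fin n → ℕ} {g h : VecFun ζ} (H : ∀ c, comp ζ c g = comp ζ c h) :
    g = h :=
  funext H

/-- The linear map to vector functions with given components. -/
def ofComps (ζ : Fin n → ℕ) {V : Type*} [AddCommGroup V] [Module ℂ V]
    (f : Comp ζ → V →ₗ[ℂ] Entire) : V →ₗ[ℂ] VecFun ζ :=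
  (LinearMap.pi f : V →ₗ[ℂ] (Comp ζ → Entire))

@[simp]
theorem comp_ofComps (ζ : Fin n → ℕ) {V : Type*} [AddCommGroup V] [Module ℂ V]
    (f : Comp ζ → V →ₗ[ℂ] Entire) (c : Comp ζ) (v : V) :
    comp ζ c (ofComps ζ f v) = f c v := rfl

open Classical in
/-- The vector function whose only nonzero component is `f`, at the index `c = (q, r)`. -/
def single (ζ : Fin n → ℕ) (c : Comp ζ) (f : Entire) : VecFun ζ :=
  (Pi.single c f : Comp ζ → Entire)

theorem comp_single_same (ζ : Fin n → ℕ) (c : Comp ζ) (f : Entire) :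
    comp ζ c (single ζ c f) = f := Pi.single_eq_same (M := fun _ => Entire) c f

theorem comp_single_ne (ζ : Fin n → ℕ) {c d : Comp ζ} (h : d ≠ c) (f : Entire) :
    comp ζ d (single ζ c f) = 0 := Pi.single_eq_of_ne (M := fun _ => Entire) h f

/-- Differentiation of the components lying in `V_q`, `q ∈ S`; the other components are
left unchanged. -/
def diffOn (ζ : Fin n → ℕ) (S : Finset (Fin n)) : Module.End ℂ (VecFun ζ) :=
  ofComps ζ fun c => if c.1 ∈ S then D ∘ₗ comp ζ c else comp ζ c

/-- Componentwise differentiation `d/dt` of vector functions. -/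
def ddt (ζ : Fin n → ℕ) : Module.End ℂ (VecFun ζ) :=
  ofComps ζ fun c => D ∘ₗ comp ζ c

/-- The solutions of `(d/dt - lam)^M g = 0` in `𝒜[t] ⊗ ⨁_q V_q`. -/
def J (ζ : Fin n → ℕ) (lam : ℂ) (M : ℕ) : Submodule ℂ (VecFun ζ) :=
  LinearMap.ker ((ddt ζ - lam • (1 : Module.End ℂ (VecFun ζ))) ^ M)

theorem diffOn_commute (ζ : Fin n → ℕ) (S : Finset (Fin n)) (lam : ℂ) (M : ℕ) :
    Commute (diffOn ζ S)
      ((ddt ζ - lam • (1 : Module.End ℂ (VecFun ζ))) ^ M) := by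
  apply Commute.pow_right
  apply Commute.sub_right
  · refine LinearMap.ext fun g => VecFun.ext fun c => ?_
    by_cases h : c.1 ∈ S <;> simp [diffOn, ddt, h]
  · exact (Commute.one_right _).smul_right lam

theorem diffOn_mem (ζ : Fin n → ℕ) (S : Finset (Fin n)) (lam : ℂ) (M : ℕ)
    (g : VecFun ζ) (hg : g ∈ J ζ lam M) : diffOn ζ S g ∈ J ζ lam M := by
  have h := LinearMap.congr_fun (diffOn_commute ζ S lam M).eq g
  have hg' : ((ddt ζ - lam • (1 : Module.End ℂ (VecFun ζ))) ^ M) g = 0 := hg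
  change ((ddt ζ - lam • (1 : Module.End ℂ (VecFun ζ))) ^ M) (diffOn ζ S g) = 0
  simpa [Module.End.mul_apply, hg'] using h.symm

/-- The operator `diffOn` restricted to `J`. -/
def diffOnJ (ζ : Fin n → ℕ) (lam : ℂ) (M : ℕ) (S : Finset (Fin n)) :
    J ζ lam M →ₗ[ℂ] J ζ lam M :=
  (diffOn ζ S).restrict (diffOn_mem ζ S lam M)

/-- The space `J(lam, α)_i`: the solutions of `(d/dt - lam)^(max α) g = 0`
(it is the same space at every vertex `i`). -/
abbrev JMod (ζ α : Fin n → ℕ) (lam : ℂ) : Submodule ℂ (VecFun ζ) :=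
  J ζ lam (Finset.univ.sup α)

/-- The arrow `a_i : J(lam, α)_i → J(lam, α)_{i+1}`: it is `d/dt` on the components in `V_i`
and the identity on all others. -/
def arrow (ζ α : Fin n → ℕ) (lam : ℂ) (i : Fin n) :
    JMod ζ α lam →ₗ[ℂ] JMod ζ α lam :=
  diffOnJ ζ lam _ {i}

/-- The path `a_{i-1} ⋯ a_1 a_0 : J(lam, α)_0 → J(lam, α)_i`: it is `d/dt` on the components
in `V_q`, `q < i`, and the identity on all others. -/
def pathFromZero (ζ α : Fin n → ℕ) (lam : ℂ) (i : Fin n) :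
    JMod ζ α lam →ₗ[ℂ] JMod ζ α lam :=
  diffOnJ ζ lam _ (Finset.univ.filter fun q => q < i)

/-! ### The basis of `J(λ, α)_i` -/

/-- The entire function `t ↦ (t^s / s!) e^{lam t}`. -/
def expMono (lam : ℂ) (s : ℕ) : Entire :=
  Entire.mk (fun t => t ^ s / (s.factorial : ℂ) * Complex.exp (lam * t)) (by fun_prop)

theorem expMono_toFun (lam : ℂ) (s : ℕ) (t : ℂ) :
    (expMono lam s).toFun t = t ^ s / (s.factorial : ℂ) * Complex.exp (lam * t) := rfl

theorem D_sub_toFun (lam : ℂ) (f : Entire) (t : ℂ) :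
    ((D - lam • (1 : Module.End ℂ Entire)) f).toFun t = deriv f.toFun t - lam * f.toFun t := by
  rw [← D_toFun]
  simp

theorem ddt_sub_pow_apply (ζ : Fin n → ℕ) (lam : ℂ) (M : ℕ) (g : VecFun ζ) (c : Comp ζ) :
    comp ζ c (((ddt ζ - lam • (1 : Module.End ℂ (VecFun ζ))) ^ M) g) =
      ((D - lam • (1 : Module.End ℂ Entire)) ^ M) (comp ζ c g) := by
  induction M generalizing g with
  | zero => simp
  | succ k ih =>
    rw [pow_succ, pow_succ, Module.End.mul_apply, Module.End.mul_apply, ih]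
    simp [ddt]

theorem hasDerivAt_exp_mul (lam t : ℂ) :
    HasDerivAt (fun t : ℂ => Complex.exp (lam * t)) (Complex.exp (lam * t) * lam) t := by
  have h1 : HasDerivAt (fun t : ℂ => lam * t) lam t := by
    simpa using (hasDerivAt_id t).const_mul lam
  exact h1.cexp

theorem D_expMono_zero (lam : ℂ) :
    (D - lam • (1 : Module.End ℂ Entire)) (expMono lam 0) = 0 := by
  refine Entire.ext fun t => ?_
  have h : (expMono lam 0).toFun = fun t => Complex.exp (lam * t) := by
    funext t
    simp [expMono_toFun]
  rw [D_sub_toFun, h, (hasDerivAt_exp_mul lam t).deriv]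
  simp [mul_comm]

theorem D_expMono_succ (lam : ℂ) (s : ℕ) :
    (D - lam • (1 : Module.End ℂ Entire)) (expMono lam (s + 1)) = expMono lam s := by
  refine Entire.ext fun t => ?_
  have h3 := ((hasDerivAt_pow (s + 1) t).div_const ((s + 1).factorial : ℂ)).mul
    (hasDerivAt_exp_mul lam t)
  have h4 : deriv (expMono lam (s + 1)).toFun t = _ := h3.deriv
  have hs : ((s.factorial : ℕ) : ℂ) ≠ 0 := Nat.cast_ne_zero.mpr s.factorial_ne_zero
  have hs' : (s : ℂ) + 1 ≠ 0 := Nat.cast_add_one_ne_zero s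
  rw [D_sub_toFun, h4, expMono_toFun, expMono_toFun]
  simp only [Nat.factorial_succ, Nat.cast_mul, Nat.cast_add, Nat.cast_one,
    Nat.add_sub_cancel]
  field_simp
  ring

theorem D_pow_expMono (lam : ℂ) (k s : ℕ) :
    ((D - lam • (1 : Module.End ℂ Entire)) ^ k) (expMono lam s) =
      if k ≤ s then expMono lam (s - k) else 0 := by
  induction k generalizing s with
  | zero => simp
  | succ k ih =>
    rw [pow_succ, Module.End.mul_apply]
    cases s with
    | zero => rw [D_expMono_zero]; simp
    | succ s =>
      rw [D_expMono_succ, ih]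
      simp

theorem expMono_apply_zero (lam : ℂ) (s : ℕ) :
    (expMono lam s).toFun 0 = if s = 0 then 1 else 0 := by
  by_cases h : s = 0 <;> simp [expMono_toFun, h]

/-- An entire solution of `(d/dt - lam)^M f = 0` with zero initial values vanishes. -/
theorem eq_zero_of_initial (lam : ℂ) (M : ℕ) (f : Entire)
    (hf : ((D - lam • (1 : Module.End ℂ Entire)) ^ M) f = 0)
    (h0 : ∀ s < M, (((D - lam • (1 : Module.End ℂ Entire)) ^ s) f).toFun 0 = 0) : f = 0 := by
  induction M generalizing f with
  | zero => simpa using hf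
  | succ M ih =>
    have h1 : (D - lam • (1 : Module.End ℂ Entire)) f = 0 := by
      apply ih
      · rw [← Module.End.mul_apply, ← pow_succ]; exact hf
      · intro s hs
        rw [← Module.End.mul_apply, ← pow_succ]
        exact h0 (s + 1) (by omega)
    have hd : ∀ t, deriv f.toFun t = lam * f.toFun t := by
      intro t
      rw [← sub_eq_zero, ← D_sub_toFun, h1]
      simp
    have h00 : f.toFun 0 = 0 := by simpa using h0 0 (by omega)
    have hF : ∀ t, HasDerivAt (fun t => f.toFun t * Complex.exp (-lam * t)) 0 t := by
      intro t
      have e1 : HasDerivAt f.toFun (lam * f.toFun t) t := by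
        rw [← hd t]; exact (f.differentiable t).hasDerivAt
      have e3 := e1.mul (hasDerivAt_exp_mul (-lam) t)
      have e4 : lam * f.toFun t * Complex.exp (-lam * t) +
          f.toFun t * (Complex.exp (-lam * t) * -lam) = 0 := by ring
      rw [e4] at e3
      exact e3
    refine Entire.ext fun t => ?_
    have hc := is_const_of_deriv_eq_zero (fun t => (hF t).differentiableAt)
      (fun t => (hF t).deriv) t 0
    simp only [h00, zero_mul] at hc
    rcases mul_eq_zero.mp hc with h | h
    · simpa using h
    · exact absurd h (Complex.exp_ne_zero _)

/-- The vector `e_{q,r,s} = (0, …, (t^s / s!) e^{lam t}, …, 0)`, whose only nonzero component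
is the component `(q, r)`. -/
def basisVec (ζ : Fin n → ℕ) (lam : ℂ) (M : ℕ) (k : Comp ζ × Fin M) : J ζ lam M :=
  ⟨single ζ k.1 (expMono lam k.2), by
    change ((ddt ζ - lam • (1 : Module.End ℂ (VecFun ζ))) ^ M) _ = 0
    refine VecFun.ext fun c => ?_
    rw [ddt_sub_pow_apply, map_zero]
    by_cases h : c = k.1
    · subst h
      rw [comp_single_same, D_pow_expMono, if_neg (by have := k.2.2; omega)]
    · rw [comp_single_ne ζ h, map_zero]⟩

/-- The initial values `((d/dt - lam)^s g_{q,r})(0)` of `g`. -/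
def initialValues (ζ : Fin n → ℕ) (lam : ℂ) (M : ℕ) :
    J ζ lam M →ₗ[ℂ] (Comp ζ × Fin M → ℂ) where
  toFun g k := (((D - lam • (1 : Module.End ℂ Entire)) ^ (k.2 : ℕ)) (comp ζ k.1 g.1)).toFun 0
  map_add' g h := by funext k; simp
  map_smul' a g := by funext k; simp

theorem initialValues_injective (ζ : Fin n → ℕ) (lam : ℂ) (M : ℕ) :
    Function.Injective (initialValues ζ lam M) := by
  refine (injective_iff_map_eq_zero (initialValues ζ lam M)).mpr fun g hg => ?_
  apply Subtype.ext
  refine VecFun.ext fun c => ?_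
  change comp ζ c g.1 = comp ζ c 0
  rw [map_zero]
  apply eq_zero_of_initial lam M
  · have h : ((ddt ζ - lam • (1 : Module.End ℂ (VecFun ζ))) ^ M) g.1 = 0 := g.2
    rw [← ddt_sub_pow_apply, h, map_zero]
  · intro s hs
    exact congrFun hg (c, ⟨s, hs⟩)

open Classical in
theorem initialValues_basisVec (ζ : Fin n → ℕ) (lam : ℂ) (M : ℕ) (k : Comp ζ × Fin M) :
    initialValues ζ lam M (basisVec ζ lam M k) = Pi.single k 1 := by
  funext l
  change (((D - lam • (1 : Module.End ℂ Entire)) ^ (l.2 : ℕ))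
    (comp ζ l.1 (single ζ k.1 (expMono lam k.2)))).toFun 0 = _
  by_cases h : l.1 = k.1
  · rw [h, comp_single_same, D_pow_expMono]
    by_cases h2 : l.2 = k.2
    · have h3 : l = k := Prod.ext h h2
      subst h3
      simp [expMono_apply_zero]
    · have hne : l ≠ k := fun e => h2 (by rw [e])
      have h3 : (l.2 : ℕ) ≠ k.2 := fun e => h2 (Fin.ext e)
      rw [Pi.single_eq_of_ne hne]
      split_ifs with h4
      · rw [expMono_apply_zero, if_neg (by omega)]
      · simp
  · have hne : l ≠ k := fun e => h (by rw [e])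
    rw [comp_single_ne ζ h, Pi.single_eq_of_ne hne]
    simp

/-- The vectors `e_{q,r,s}`, `0 ≤ s < M`, form a basis of `J`. -/
def basisJ (ζ : Fin n → ℕ) (lam : ℂ) (M : ℕ) :
    Module.Basis (Comp ζ × Fin M) ℂ (J ζ lam M) :=
  Module.Basis.mk (v := basisVec ζ lam M)
    (by
      apply LinearIndependent.of_comp (initialValues ζ lam M)
      have : (initialValues ζ lam M) ∘ basisVec ζ lam M = Pi.basisFun ℂ (Comp ζ × Fin M) := by
        funext k
        rw [Function.comp_apply, initialValues_basisVec, Pi.basisFun_apply]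
      rw [this]
      exact (Pi.basisFun ℂ _).linearIndependent)
    (by
      intro g _
      have : g = ∑ k, initialValues ζ lam M g k • basisVec ζ lam M k := by
        apply initialValues_injective
        rw [map_sum]
        funext l
        simp [initialValues_basisVec, Pi.single_apply]
      rw [this]
      exact Submodule.sum_mem _ fun k _ =>
        Submodule.smul_mem _ _ (Submodule.subset_span ⟨k, rfl⟩))

/-! ### Plücker coordinates -/

/-- Triples of indices `((q, r), s)`; a triple with `s` out of range is allowed, and the
corresponding coordinate is zero. -/
abbrev Idx (ζ : Fin n → ℕ) : Type := Comp ζ × ℕ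

/-- The coordinate functional belonging to `e_{q,r,s}`, zero when `s` is out of range. -/
def coordFn (ζ : Fin n → ℕ) (lam : ℂ) (M : ℕ) (k : Idx ζ) : Module.Dual ℂ (J ζ lam M) :=
  if h : k.2 < M then (basisJ ζ lam M).coord (k.1, ⟨k.2, h⟩) else 0

/-- The coordinate `p_{K_1 … K_m}` of `ω ∈ ⋀^m J` with respect to the basis `e_{q,r,s}`, for an
arbitrary tuple `K`: it is alternating in `K` and is the determinant
of the coordinates `(v_b)_{K_a}` when `ω = v_1 ∧ … ∧ v_m`. -/
def plk {ζ : Fin n → ℕ} {lam : ℂ} {M m : ℕ} (ω : ⋀[ℂ]^m (J ζ lam M)) (K : Fin m → Idx ζ) : ℂ :=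
  exteriorPower.pairingDual ℂ (J ζ lam M) m
    (exteriorPower.ιMulti ℂ m fun a => coordFn ζ lam M (K a)) ω

theorem plk_ιMulti {ζ : Fin n → ℕ} {lam : ℂ} {M m : ℕ} (v : Fin m → J ζ lam M)
    (K : Fin m → Idx ζ) :
    plk (exteriorPower.ιMulti ℂ m v) K =
      Matrix.det (Matrix.of fun b a => coordFn ζ lam M (K a) (v b)) := by
  simp [plk]

/-- The Plücker equations. -/
def PluckerEqs {ζ : Fin n → ℕ} {lam : ℂ} {M m : ℕ} (ω : ⋀[ℂ]^m (J ζ lam M)) : Prop :=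
  ∀ (m' : ℕ) (h : m = m' + 1) (A : Fin m' → Idx ζ) (B : Fin (m + 1) → Idx ζ),
    ∑ l : Fin (m + 1), (-1 : ℂ) ^ (l : ℕ) *
      plk ω (Fin.snoc (α := fun _ => Idx ζ) A (B l) ∘ Fin.cast h) *
      plk ω (B ∘ l.succAbove) = 0

/-- The equations `p_K = 0` for the tuples `K`, ordered by nondecreasing `s`, whose `j`-th
entry has `s ≥ j` for some `1 ≤ j ≤ m`. -/
def VanishingEqs {ζ : Fin n → ℕ} {lam : ℂ} {M m : ℕ} (ω : ⋀[ℂ]^m (J ζ lam M)) : Prop :=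
  ∀ K : Fin m → Idx ζ, Monotone (fun a => (K a).2) → (∃ j : Fin m, (j : ℕ) < (K j).2) →
    plk ω K = 0

/-- The equations `∑_{ε ≠ 0} p_{K + ε} = 0`, where `ε ∈ {0, 1}^m` is added to the third
entries `s` of the triples of `K`, and the set `E` is the support of `ε`. -/
def ShiftEqs {ζ : Fin n → ℕ} {lam : ℂ} {M m : ℕ} (ω : ⋀[ℂ]^m (J ζ lam M)) : Prop :=
  ∀ K : Fin m → Idx ζ,
    ∑ E ∈ (Finset.univ : Finset (Finset (Fin m))).filter (fun E => E.Nonempty),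
      plk ω (fun a => if a ∈ E then ((K a).1, (K a).2 + 1) else K a) = 0

/-- The operation `k ↦ k'` at the vertex `i`: `(q, r, s)' = (q, r, s + 1)` if `q = i`, and
`k' = k` otherwise. -/
def prime {ζ : Fin n → ℕ} (i : Fin n) (k : Idx ζ) : Idx ζ :=
  if k.1.1 = i then (k.1, k.2 + 1) else k

/-- The equations (a): Plücker, vanishing and shift equations on every factor. -/
def EqsA {ζ α : Fin n → ℕ} {lam : ℂ} (ω : ∀ i, ⋀[ℂ]^(α i) (JMod ζ α lam)) : Prop :=
  ∀ i, PluckerEqs (ω i) ∧ VanishingEqs (ω i) ∧ ShiftEqs (ω i)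

/-- The equations (b), `p⁽ⁱ⁾_J p⁽ⁱ⁺¹⁾_K = p⁽ⁱ⁾_K p⁽ⁱ⁺¹⁾_J`, which make sense when `α` is
constant. -/
def EqsB [NeZero n] {ζ α : Fin n → ℕ} {lam : ℂ} (hα : ∀ i, α i = α (i + 1))
    (ω : ∀ i, ⋀[ℂ]^(α i) (JMod ζ α lam)) : Prop :=
  ∀ (i : Fin n) (A K : Fin (α i) → Idx ζ),
    plk (ω i) A * plk (ω (i + 1)) (K ∘ Fin.cast (hα i).symm) =
      plk (ω i) K * plk (ω (i + 1)) (A ∘ Fin.cast (hα i).symm)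

/-- The equations (c), `∑_l (-1)^l p⁽ⁱ⁾_{j_1 … j_{α_i - 1} k_l'} p⁽ⁱ⁺¹⁾_{k_0 … k̂_l …} = 0`, for all
`j` with third entries `< α_i` and all `k`. There is none for a vertex `i` with `α_i = 0`. -/
def EqsC [NeZero n] {ζ α : Fin n → ℕ} {lam : ℂ}
    (ω : ∀ i, ⋀[ℂ]^(α i) (JMod ζ α lam)) : Prop :=
  ∀ (i : Fin n) (m' : ℕ) (h : α i = m' + 1) (A : Fin m' → Idx ζ)
    (K : Fin (α (i + 1) + 1) → Idx ζ), (∀ a, (A a).2 < α i) →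
    ∑ l : Fin (α (i + 1) + 1), (-1 : ℂ) ^ (l : ℕ) *
      plk (ω i) (Fin.snoc (α := fun _ => Idx ζ) A (prime i (K l)) ∘ Fin.cast h) *
      plk (ω (i + 1)) (K ∘ l.succAbove) = 0

/-! ### Varieties as quotients of quasi-affine sets

The classical (reduced) structure of a variety on a Grassmannian or on a projective space
comes from the affine cone: a set `X` with a surjection `π : S → X` from a subset `S` of a
finite-dimensional vector space gets the quotient of the Zariski topology, and a function on
an open subset of `X` is regular if its pull-back to `S` is. For `S` the set of bases of the
points of a Grassmannian, or the set of nonzero representatives of the points of a projective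
space, `π` is a Zariski locally trivial principal bundle, so that these are the usual notions. -/

section Varieties

variable {A B X Y : Type*} [AddCommGroup A] [Module ℂ A] [AddCommGroup B] [Module ℂ B]

/-- Polynomial functions on a vector space. -/
def polyFun (A : Type*) [AddCommGroup A] [Module ℂ A] : Subalgebra ℂ (A → ℂ) :=
  Algebra.adjoin ℂ (Set.range fun φ : Module.Dual ℂ A => (φ : A → ℂ))

/-- The Zariski topology of a vector space. -/
abbrev zariski (A : Type*) [AddCommGroup A] [Module ℂ A] : TopologicalSpace A :=
  TopologicalSpace.generateFrom {U | ∃ p ∈ polyFun A, U = {x | p x ≠ 0}}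

/-- The quotient Zariski topology on `X` defined by `π : S → X`. -/
abbrev quotZariski {S : Set A} (π : S → X) : TopologicalSpace X :=
  TopologicalSpace.coinduced π (TopologicalSpace.induced Subtype.val (zariski A))

/-- `f` is regular on `U`: its pull-back to `S` is locally a quotient of polynomials. -/
def IsRegularOn {S : Set A} (π : S → X) (U : Set X) (f : X → ℂ) : Prop :=
  ∀ x : S, π x ∈ U → ∃ p ∈ polyFun A, ∃ q ∈ polyFun A, q x ≠ 0 ∧
    ∀ y : S, π y ∈ U → q y ≠ 0 → f (π y) = p y / q y

/-- The bijection `e` is an isomorphism of varieties: it identifies the Zariski topologies and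
the regular functions on open sets. -/
structure IsVarietyIso {S : Set A} {T : Set B} (π : S → X) (ρ : T → Y) (e : X ≃ Y) : Prop where
  isOpen_iff : ∀ U : Set Y, IsOpen[quotZariski ρ] U ↔ IsOpen[quotZariski π] (e ⁻¹' U)
  isRegularOn_iff : ∀ U : Set Y, IsOpen[quotZariski ρ] U → ∀ f : Y → ℂ,
    IsRegularOn ρ U f ↔ IsRegularOn π (e ⁻¹' U) (f ∘ e)

end Varieties

section Cones

variable {W : Fin n → Type*} [∀ i, AddCommGroup (W i)] [∀ i, Module ℂ (W i)]

/-- The representatives of the points of a subset `Z` of a product of projective spaces. -/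
def projCone (Z : Set (∀ i, ℙ ℂ (W i))) : Set (∀ i, W i) :=
  {w | ∃ h : ∀ i, w i ≠ 0, (fun i => Projectivization.mk ℂ (w i) (h i)) ∈ Z}

/-- The projection from representatives to points. -/
def projConeMap (Z : Set (∀ i, ℙ ℂ (W i))) (w : projCone Z) : Z :=
  ⟨fun i => Projectivization.mk ℂ (w.1 i) (w.2.choose i), w.2.choose_spec⟩

/-- The tuples of bases of the points of a set `X` of tuples of `α_i`-dimensional subspaces. -/
def frames (α : Fin n → ℕ) (X : Set (∀ i, Submodule ℂ (W i))) : Set (∀ i, Fin (α i) → W i) :=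
  {u | (∀ i, LinearIndependent ℂ (u i)) ∧ (fun i => Submodule.span ℂ (Set.range (u i))) ∈ X}

/-- The projection from tuples of bases to tuples of subspaces. -/
def framesMap (α : Fin n → ℕ) (X : Set (∀ i, Submodule ℂ (W i))) (u : frames α X) : X :=
  ⟨fun i => Submodule.span ℂ (Set.range (u.1 i)), u.2.2⟩

end Cones

/-! ### The quiver Grassmannian and the subvarieties of the product of projective spaces -/

/-- `Grass_α(J(lam, α))`: the tuples `(U_i)` of subspaces `U_i ⊆ J(lam, α)_i` with
`dim U_i = α_i` and `a_i(U_i) ⊆ U_{i+1}` (vertices are numbered by `ℤ/n`). -/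
def Grass [NeZero n] (ζ α : Fin n → ℕ) (lam : ℂ) :
    Set (Fin n → Submodule ℂ (JMod ζ α lam)) :=
  {U | (∀ i, Module.finrank ℂ (U i) = α i) ∧
    ∀ i, (U i).map (arrow ζ α lam i) ≤ U (i + 1)}

/-- The product of the projective spaces `ℙ(⋀^{α_i} J(lam, α)_i)`. -/
abbrev ProdProj (ζ α : Fin n → ℕ) (lam : ℂ) : Type :=
  ∀ i, ℙ ℂ (⋀[ℂ]^(α i) (JMod ζ α lam))

/-- The subvariety given by (a) and (b). -/
def varAB [NeZero n] (ζ α : Fin n → ℕ) (lam : ℂ) (hα : ∀ i, α i = α (i + 1)) :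
    Set (ProdProj ζ α lam) :=
  {P | EqsA (fun i => (P i).rep) ∧ EqsB hα (fun i => (P i).rep)}

/-- The subvariety given by (a) and (c). -/
def varAC [NeZero n] (ζ α : Fin n → ℕ) (lam : ℂ) : Set (ProdProj ζ α lam) :=
  {P | EqsA (fun i => (P i).rep) ∧ EqsC (fun i => (P i).rep)}

/-- `P` is the Plücker point of the `m`-dimensional subspace `U`: the line spanned by
`u_1 ∧ … ∧ u_m` for every basis `u` of `U`. -/
def IsPluckerPoint {V : Type*} [AddCommGroup V] [Module ℂ V] {m : ℕ}
    (P : ℙ ℂ (⋀[ℂ]^m V)) (U : Submodule ℂ V) : Prop :=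
  ∀ u : Fin m → V, LinearIndependent ℂ u → Submodule.span ℂ (Set.range u) = U →
    P.submodule = Submodule.span ℂ {exteriorPower.ιMulti ℂ m u}

end CyclicQuiver

end

/-!
The correspondence between subspaces and their Plücker points is reduced to linear algebra in
the alternating form `altForm ω` on the dual space of `J` whose values on coordinate functionals
are the Plücker coordinates of `ω`. If the Plücker equations hold and the coordinate of `ω` at a
tuple `φ` of functionals is nonzero, then the vectors `slot φ b ω`, which depend linearly on `ω`
and whose coordinates are those of `ω` at the tuples with one entry of `φ` replaced, form a basis
of a subspace with Plücker point `[ω]` (`mul_det_of_plucker`, `ιMulti_slot`). The subspace is also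
recovered as `{y | y ∧ ω = 0}` (`wedgeForm_eq_zero_iff`).

This yields the isomorphism of varieties from a bijection of points: bases of subspaces map
polynomially to wedge products, and `slot` gives linear lifts in the other direction on the open
sets where a given coordinate is nonzero (`isVarietyIso_of_lifts`, `exists_isVarietyIso`).

It remains to interpret the equations. With `N = d/dt - lam`, which is nilpotent on `J`, the shift
equations say that `⋀(1 + N)` fixes `ω`, that is, that the subspace is `N`-invariant
(`shiftEqs_iff`, `ShiftEqs.invariant`); conversely `1 + N` has determinant `1` on an invariant
subspace. The vanishing equations follow from invariance, since the kernel of `N ^ k` on an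
`m`-dimensional invariant subspace has dimension at least `k` for `k ≤ m`
(`altForm_eq_zero_of_factor`). The equations (c) say that an arrow maps the contractions of one
vector, which span its subspace, into the next subspace (`incidence_of_map_mem`,
`wedgeForm_slot_eq_zero`).

On the Grassmannian, going once around the quiver shows that each `U_i` is invariant under `d/dt`.
For `lam = 0` this is invariance under `N`, and the conditions on the arrows are the equations (c).
For `lam ≠ 0` all arrows are bijective, so the dimensions agree and all `U_i` are images of the
single invariant subspace `U_0` (`Grass.comap_path_eq`); the equations (b) say that the
pulled-back Plücker points coincide.
-/

noncomputable section

namespace CyclicQuiver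

open Module

/-! ### Plücker coordinates as alternating forms on the dual space -/

section AlternatingForms

variable {F V : Type*} [Field F] [AddCommGroup V] [Module F V] {m : ℕ}

/-- The alternating form `(ψ₁, …, ψ_m) ↦ ⟨ψ₁ ∧ … ∧ ψ_m, ω⟩` on the dual space: its values on
tuples of coordinate functionals are the Plücker coordinates of `ω`. -/
def altForm (m : ℕ) : ⋀[F]^m V →ₗ[F] (Dual F V) [⋀^Fin m]→ₗ[F] F where
  toFun ω := (Dual.eval F _ ω).compAlternatingMap (exteriorPower.alternatingMapToDual F V m)
  map_add' ω ω' := by ext ψ; simp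
  map_smul' c ω := by ext ψ; simp

theorem altForm_apply (ω : ⋀[F]^m V) (ψ : Fin m → Dual F V) :
    altForm m ω ψ = exteriorPower.pairingDual F V m (exteriorPower.ιMulti F m ψ) ω := by
  simp [altForm, exteriorPower.pairingDual]

theorem altForm_ιMulti (v : Fin m → V) (ψ : Fin m → Dual F V) :
    altForm m (exteriorPower.ιMulti F m v) ψ = Matrix.det (Matrix.of fun b a => ψ a (v b)) := by
  rw [altForm_apply, exteriorPower.pairingDual_ιMulti_ιMulti]

theorem altForm_injective [FiniteDimensional F V] :
    Function.Injective (altForm m : ⋀[F]^m V →ₗ[F] (Dual F V) [⋀^Fin m]→ₗ[F] F) := by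
  refine (injective_iff_map_eq_zero _).2 fun ω h => ?_
  refine ((finBasis F V).exteriorPower m).ext_elem fun s => ?_
  rw [exteriorPower.basis_repr_apply, exteriorPower.ιMultiDual,
    exteriorPower.ιMulti_family, ← altForm_apply, h]
  simp

/-- The form of the wedge product of independent vectors takes the value `1` on a dual family. -/
theorem altForm_ιMulti_ne_zero {v : Fin m → V} (hv : LinearIndependent F v) :
    altForm m (exteriorPower.ιMulti F m v) ≠ 0 := by
  obtain ⟨g, hg⟩ := (Fintype.linearCombination F v).exists_leftInverse_of_injective
    (LinearMap.ker_eq_bot.2 (linearIndependent_iff_injective_fintypeLinearCombination.1 hv))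
  intro h
  have h1 : ∀ b, g (v b) = Pi.single b 1 := fun b => by
    have := LinearMap.congr_fun hg (Pi.single b 1)
    simpa [Fintype.linearCombination_apply_single] using this
  have h2 := DFunLike.congr_fun h fun a => LinearMap.proj a ∘ₗ g
  rw [altForm_ιMulti] at h2
  have h3 : (Matrix.of fun b a : Fin m => (LinearMap.proj a ∘ₗ g : Dual F V) (v b)) = 1 := by
    ext b a
    simp [h1, Matrix.one_apply, Pi.single_apply, eq_comm]
  rw [h3] at h2
  simp at h2

theorem exists_basis_ne_zero {E ι : Type*} [AddCommGroup E] [Module F E] (b : Basis ι F E)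
    {P : E [⋀^Fin m]→ₗ[F] F} (hP : P ≠ 0) : ∃ K : Fin m → ι, P (b ∘ K) ≠ 0 := by
  by_contra! h
  exact hP (Basis.ext_alternating b fun K _ => h K)

/-! ### The subspace defined by an alternating form -/

/-- The alternating form of `y ∧ ω`, in terms of the form `P` of `ω`. -/
def wedgeForm (P : (Dual F V) [⋀^Fin m]→ₗ[F] F) (y : V) : (Dual F V) [⋀^Fin (m + 1)]→ₗ[F] F :=
  AlternatingMap.alternatizeUncurryFin ((Dual.eval F V y).smulRight P)

theorem wedgeForm_apply (P : (Dual F V) [⋀^Fin m]→ₗ[F] F) (y : V) (B : Fin (m + 1) → Dual F V) :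
    wedgeForm P y B = ∑ l : Fin (m + 1), (-1) ^ (l : ℕ) * (B l y * P (B ∘ l.succAbove)) := by
  simp only [wedgeForm, AlternatingMap.alternatizeUncurryFin_apply]
  refine Finset.sum_congr rfl fun l _ => ?_
  have : l.removeNth B = B ∘ l.succAbove := rfl
  rcases Nat.even_or_odd (l : ℕ) with h | h <;> simp [this, h.neg_one_pow]

theorem wedgeForm_smul (c : F) (P : (Dual F V) [⋀^Fin m]→ₗ[F] F) (y : V) :
    wedgeForm (c • P) y = c • wedgeForm P y := by
  ext B
  simp only [wedgeForm_apply, AlternatingMap.smul_apply, smul_eq_mul, Finset.mul_sum]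
  exact Finset.sum_congr rfl fun l _ => by ring

/-- Expansion of a determinant along the row of `y`. -/
theorem wedgeForm_ιMulti (w : Fin m → V) (y : V) :
    wedgeForm (altForm m (exteriorPower.ιMulti F m w)) y =
      altForm (m + 1) (exteriorPower.ιMulti F (m + 1) (Fin.cons y w : Fin (m + 1) → V)) := by
  ext B
  rw [wedgeForm_apply, altForm_ιMulti, Matrix.det_succ_row_zero]
  refine Finset.sum_congr rfl fun l _ => ?_
  rw [altForm_ιMulti, mul_assoc]
  rfl

/-- A vector `y` lies in the span of the independent family `w` if and only if
`y ∧ w₁ ∧ … ∧ w_m = 0`. -/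
theorem wedgeForm_eq_zero_iff {w : Fin m → V} (hw : LinearIndependent F w) {y : V} :
    wedgeForm (altForm m (exteriorPower.ιMulti F m w)) y = 0 ↔
      y ∈ Submodule.span F (Set.range w) := by
  rw [wedgeForm_ιMulti]
  constructor
  · intro h
    by_contra hy
    exact altForm_ιMulti_ne_zero (linearIndependent_finCons.2 ⟨hw, hy⟩) h
  · intro hy
    rw [AlternatingMap.map_linearDependent _ _ fun h => (linearIndependent_finCons.1 h).2 hy,
      map_zero]

theorem wedgeForm_eq_zero_of_mem {w : Fin m → V} {y : V}
    (hy : y ∈ Submodule.span F (Set.range w)) :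
    wedgeForm (altForm m (exteriorPower.ιMulti F m w)) y = 0 := by
  rw [wedgeForm_ιMulti,
    AlternatingMap.map_linearDependent _ _ fun h => (linearIndependent_finCons.1 h).2 hy, map_zero]

/-- A contraction of `v₁ ∧ … ∧ v_{m+1}` lies in the span of the `v_b`. -/
theorem exists_contraction (v : Fin (m + 1) → V) (A : Fin m → Dual F V) :
    ∃ z ∈ Submodule.span F (Set.range v), ∀ ψ : Dual F V,
      altForm (m + 1) (exteriorPower.ιMulti F (m + 1) v)
        (Fin.snoc (α := fun _ => Dual F V) A ψ) = ψ z := by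
  refine ⟨∑ b : Fin (m + 1), ((-1) ^ (b + Fin.last m : ℕ) *
      Matrix.det (Matrix.of fun b' a => A a (v (b.succAbove b')))) • v b,
    Submodule.sum_mem _ fun b _ => Submodule.smul_mem _ _ (Submodule.subset_span ⟨b, rfl⟩),
    fun ψ => ?_⟩
  rw [altForm_ιMulti, Matrix.det_succ_column _ (Fin.last m), map_sum]
  refine Finset.sum_congr rfl fun b _ => ?_
  rw [map_smul, smul_eq_mul, Matrix.of_apply, Fin.snoc_last, mul_right_comm]
  congr 3
  ext b' a
  simp [Matrix.submatrix_apply, Fin.succAbove_last]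

/-! ### Forms satisfying the Plücker equations -/

/-- The vector `v` with `ψ v = P (φ₁, …, ψ, …, φ_m)` for all `ψ`, where `ψ` is in place `b`. -/
def slot [FiniteDimensional F V] (φ : Fin m → Dual F V) (b : Fin m) : ⋀[F]^m V →ₗ[F] V where
  toFun ω := (evalEquiv F V).symm ((altForm m ω).toMultilinearMap.toLinearMap φ b)
  map_add' ω ω' := by
    rw [← map_add]; congr 1; ext ψ; simp
  map_smul' c ω := by
    rw [RingHom.id_apply, ← map_smul]; congr 1; ext ψ; simp

theorem apply_slot [FiniteDimensional F V] (φ : Fin m → Dual F V) (b : Fin m) (ω : ⋀[F]^m V)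
    (ψ : Dual F V) : ψ (slot φ b ω) = altForm m ω (Function.update φ b ψ) := by
  have := apply_evalEquiv_symm_apply F V ψ ((altForm m ω).toMultilinearMap.toLinearMap φ b)
  exact this

/-- The Plücker relation for `A` and `(ψ, φ₀, …, φ_m)`, solved for the leading term. -/
theorem plucker_exchange {E : Type*} [AddCommGroup E] [Module F E]
    (P : E [⋀^Fin (m + 1)]→ₗ[F] F) (A : Fin m → E) (ψ : E) (φ : Fin (m + 1) → E)
    (h : ∑ l : Fin (m + 2), (-1 : F) ^ (l : ℕ) *
      P (Fin.snoc (α := fun _ => E) A ((Fin.cons ψ φ : Fin (m + 2) → E) l)) *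
      P ((Fin.cons ψ φ : Fin (m + 2) → E) ∘ l.succAbove) = 0) :
    P (Fin.snoc (α := fun _ => E) A ψ) * P φ =
      ∑ b, P (Function.update φ b ψ) * P (Fin.snoc (α := fun _ => E) A (φ b)) := by
  rw [Fin.sum_univ_succ] at h
  have h0 : (Fin.cons ψ φ : Fin (m + 2) → E) ∘ (0 : Fin (m + 2)).succAbove = φ := by
    ext b; simp
  rw [h0] at h
  simp only [Fin.val_zero, pow_zero, one_mul, Fin.cons_zero] at h
  rw [eq_neg_of_add_eq_zero_left h, ← Finset.sum_neg_distrib]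
  refine Finset.sum_congr rfl fun b _ => ?_
  have h1 : (Fin.cons ψ φ : Fin (m + 2) → E) ∘ b.succ.succAbove
      = Matrix.vecCons ψ (b.removeNth φ) := by
    ext a
    refine Fin.cases ?_ (fun a => ?_) a <;> simp [Matrix.vecCons, Fin.removeNth]
  rw [h1, ← AlternatingMap.neg_one_pow_smul_map_insertNth P b, Fin.insertNth_removeNth,
    Fin.cons_succ, Fin.val_succ]
  rcases Nat.even_or_odd (b : ℕ) with hb | hb
  · simp [hb.neg_one_pow, pow_succ]; ring
  · simp [hb.neg_one_pow, pow_succ]; ring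

/-- If an operator may be applied to the last argument of an alternating form without changing its
value, then it may be applied to all arguments. -/
theorem map_comp_eq_of_map_snoc {E : Type*} [AddCommGroup E] [Module F E]
    (P : E [⋀^Fin (m + 1)]→ₗ[F] F) (T : E →ₗ[F] E)
    (h : ∀ (A : Fin m → E) (ψ : E), P (Fin.snoc (α := fun _ => E) A ψ) =
      P (Fin.snoc (α := fun _ => E) A (T ψ))) (ψ : Fin (m + 1) → E) :
    P (T ∘ ψ) = P ψ := by
  -- the last place can be exchanged with any other one
  have h1 : ∀ (ψ : Fin (m + 1) → E) a, P (Function.update ψ a (T (ψ a))) = P ψ := by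
    intro ψ a
    have h2 : ∀ χ : Fin (m + 1) → E,
        P (Function.update χ (Fin.last m) (T (χ (Fin.last m)))) = P χ := fun χ => by
      have := h (Fin.init χ) (χ (Fin.last m))
      rw [Fin.snoc_init_self] at this
      rw [this, ← Fin.update_snoc_last (α := fun _ => E) (χ (Fin.last m)), Fin.snoc_init_self]
    have h3 := h2 (ψ ∘ Equiv.swap a (Fin.last m))
    have h4 : Function.update (ψ ∘ Equiv.swap a (Fin.last m)) (Fin.last m)
        (T ((ψ ∘ Equiv.swap a (Fin.last m)) (Fin.last m))) =
        Function.update ψ a (T (ψ a)) ∘ Equiv.swap a (Fin.last m) := by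
      rw [Function.update_comp_equiv]
      simp
    rw [h4, AlternatingMap.map_perm, AlternatingMap.map_perm] at h3
    exact smul_left_cancel _ h3
  have h2 : ∀ s : Finset (Fin (m + 1)), P (s.piecewise (T ∘ ψ) ψ) = P ψ := by
    intro s
    induction s using Finset.induction_on with
    | empty => simp
    | insert a s ha ih =>
      rw [← ih, ← h1 (s.piecewise (T ∘ ψ) ψ) a, Finset.piecewise_insert,
        Finset.piecewise_eq_of_notMem _ _ _ ha]
      rfl
  simpa using h2 Finset.univ

/-- If `P` satisfies the Plücker relations for the tuples of elements of a basis, then at a basis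
tuple `φ = b ∘ K` with `P φ ≠ 0` the arguments of `P` may be projected to the span of `φ`; the
projection has the coordinates `P (φ₁, …, ψ, …, φ_m) / P φ`. -/
theorem mul_det_of_plucker {E ι : Type*} [AddCommGroup E] [Module F E] [Finite ι]
    (b : Basis ι F E)
    (P : E [⋀^Fin m]→ₗ[F] F)
    (hP : ∀ (m' : ℕ) (h : m = m' + 1) (A : Fin m' → ι) (B : Fin (m + 1) → ι),
      ∑ l : Fin (m + 1), (-1 : F) ^ (l : ℕ) *
        P (Fin.snoc (α := fun _ => E) (b ∘ A) (b (B l)) ∘ Fin.cast h) *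
        P (b ∘ B ∘ l.succAbove) = 0)
    (K : Fin m → ι) (hK : P (b ∘ K) ≠ 0) (ψ : Fin m → E) :
    P (b ∘ K) * Matrix.det (Matrix.of fun c a => P (Function.update (b ∘ K) c (ψ a))) =
      P (b ∘ K) ^ m * P ψ := by
  cases m with
  | zero =>
    rw [Subsingleton.elim ψ (b ∘ K)]
    simp
  | succ m =>
    set φ := b ∘ K with hφ
    let T : E →ₗ[F] E := (P φ)⁻¹ • ∑ c, (P.toMultilinearMap.toLinearMap φ c).smulRight (φ c)
    have hT : ∀ χ, T χ = ∑ c, ((P φ)⁻¹ * P (Function.update φ c χ)) • φ c := fun χ => by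
      simp [T, Finset.smul_sum, mul_smul]
    -- `P (A, χ) = P (A, T χ)` is linear in `χ` and multilinear in `A`, so basis elements suffice
    have h1 : P.toMultilinearMap.curryRight =
        (LinearMap.lcomp F F T).compMultilinearMap P.toMultilinearMap.curryRight := by
      refine Basis.ext_multilinear (fun _ => b) fun A => b.ext fun k => ?_
      have h2 := plucker_exchange P (b ∘ A) (b k) φ ?_
      · simp only [LinearMap.compMultilinearMap_apply, LinearMap.lcomp_apply]
        rw [hT, map_sum]
        simp only [map_smul, MultilinearMap.curryRight_apply]
        change P (Fin.snoc (α := fun _ => E) (b ∘ A) (b k)) =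
          ∑ c, _ • P (Fin.snoc (α := fun _ => E) (b ∘ A) (φ c))
        rw [eq_div_of_mul_eq hK h2, Finset.sum_div]
        refine Finset.sum_congr rfl fun c _ => ?_
        rw [smul_eq_mul]
        ring
      · have h3 := hP m rfl A (Fin.cons k K)
        have h4 : (b ∘ (Fin.cons k K : Fin (m + 2) → ι)) =
            (Fin.cons (b k) φ : Fin (m + 2) → E) := by
          rw [hφ, Fin.comp_cons]
        rw [← h4]
        exact h3
    have h5 := map_comp_eq_of_map_snoc P T (fun A χ =>
      LinearMap.congr_fun (DFunLike.congr_fun h1 A) χ) ψ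
    -- on the span of `φ` the form is a multiple of the determinant
    have h6 := (P.compLinearMap (Fintype.linearCombination F φ)).eq_smul_basis_det
      (Pi.basisFun F (Fin (m + 1)))
    have h7 := DFunLike.congr_fun h6 fun a c => (P φ)⁻¹ * P (Function.update φ c (ψ a))
    have h8 : (Matrix.of fun a c => (P φ)⁻¹ * P (Function.update φ c (ψ a))) =
        (P φ)⁻¹ • (Matrix.of fun c a => P (Function.update φ c (ψ a))).transpose := by
      ext; simp
    have h9 : (fun a => Fintype.linearCombination F φ (Pi.basisFun F (Fin (m + 1)) a)) = φ := by
      ext a; simp [Fintype.linearCombination_apply_single]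
    have h10 : (fun a => Fintype.linearCombination F φ
        fun c => (P φ)⁻¹ * P (Function.update φ c (ψ a))) = T ∘ ψ := by
      ext a; simp [hT, Fintype.linearCombination_apply]
    have h11 : (Pi.basisFun F (Fin (m + 1))).det
        (fun a c => (P φ)⁻¹ * P (Function.update φ c (ψ a))) = (P φ)⁻¹ ^ (m + 1) *
          Matrix.det (Matrix.of fun c a => P (Function.update φ c (ψ a))) := by
      rw [Pi.basisFun_det_apply, h8, Matrix.det_smul, Matrix.det_transpose, Fintype.card_fin]
    simp only [AlternatingMap.compLinearMap_apply, AlternatingMap.smul_apply, smul_eq_mul] at h7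
    rw [h11] at h7
    simp only [h9, h10, h5] at h7
    have h12 : P φ ^ (m + 1) * (P φ)⁻¹ ^ (m + 1) = 1 := by
      rw [← mul_pow, mul_inv_cancel₀ hK, one_pow]
    rw [h7]
    linear_combination
      -(P φ * Matrix.det (Matrix.of fun c a => P (Function.update φ c (ψ a)))) * h12

end AlternatingForms

/-! ### Plücker points -/

section PluckerPoints

variable {F V : Type*} [Field F] [AddCommGroup V] [Module F V] {m : ℕ}

theorem ιMulti_ne_zero {u : Fin m → V} (hu : LinearIndependent F u) :
    exteriorPower.ιMulti F m u ≠ 0 := fun h =>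
  altForm_ιMulti_ne_zero hu (by rw [h, map_zero])

/-- The wedge product of `m` vectors of an `m`-dimensional subspace, relative to a basis. -/
theorem ιMulti_eq_det_smul {U : Submodule F V} (e : Basis (Fin m) F U) (w : Fin m → U) :
    exteriorPower.ιMulti F m (fun a => (w a : V)) =
      e.det w • exteriorPower.ιMulti F m (fun a => (e a : V)) := by
  rw [← sub_eq_zero, ← forall_dual_apply_eq_zero_iff F]
  intro φ
  have h := DFunLike.congr_fun (((φ.compAlternatingMap
    (exteriorPower.ιMulti F m)).compLinearMap U.subtype).eq_smul_basis_det e) w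
  simp only [AlternatingMap.compLinearMap_apply, LinearMap.compAlternatingMap_apply,
    AlternatingMap.smul_apply, Submodule.subtype_apply, smul_eq_mul] at h
  rw [map_sub, map_smul, h, smul_eq_mul, mul_comm, sub_self]

/-- Decomposable vectors satisfy the Plücker equations: these say that contractions of `ω` lie in
the subspace of `ω`. -/
theorem plucker_of_decomposable {ω : ⋀[F]^m V} {c : F} {u : Fin m → V}
    (hω : ω = c • exteriorPower.ιMulti F m u) (m' : ℕ) (h : m = m' + 1)
    (A : Fin m' → Dual F V) (B : Fin (m + 1) → Dual F V) :
    ∑ l : Fin (m + 1), (-1 : F) ^ (l : ℕ) *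
      altForm m ω (Fin.snoc (α := fun _ => Dual F V) A (B l) ∘ Fin.cast h) *
      altForm m ω (B ∘ l.succAbove) = 0 := by
  subst h
  obtain ⟨z, hz, hzA⟩ := exists_contraction u A
  have h1 := DFunLike.congr_fun (wedgeForm_eq_zero_of_mem hz) B
  rw [wedgeForm_apply, AlternatingMap.zero_apply] at h1
  simp only [hω, map_smul, AlternatingMap.smul_apply, smul_eq_mul, Fin.cast_refl,
    Function.comp_id, hzA]
  trans (c * c) * 0
  · rw [← h1, Finset.mul_sum]
    exact Finset.sum_congr rfl fun l _ => by ring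
  · simp

/-- A vector satisfying the Plücker equations is decomposable: it is a multiple of the
wedge product of its slots at a nonzero coordinate. -/
theorem ιMulti_slot [FiniteDimensional F V] {ι : Type*} [Finite ι] (b : Basis ι F (Dual F V))
    {ω : ⋀[F]^m V}
    (hω : ∀ (m' : ℕ) (h : m = m' + 1) (A : Fin m' → ι) (B : Fin (m + 1) → ι),
      ∑ l : Fin (m + 1), (-1 : F) ^ (l : ℕ) *
        altForm m ω (Fin.snoc (α := fun _ => Dual F V) (b ∘ A) (b (B l)) ∘ Fin.cast h) *
        altForm m ω (b ∘ B ∘ l.succAbove) = 0)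
    {K : Fin m → ι} (hK : altForm m ω (b ∘ K) ≠ 0) :
    exteriorPower.ιMulti F m (fun c => slot (b ∘ K) c ω) =
      (altForm m ω (b ∘ K) ^ m * (altForm m ω (b ∘ K))⁻¹) • ω := by
  apply altForm_injective
  ext ψ
  have h := mul_det_of_plucker b (altForm m ω) hω K hK ψ
  rw [altForm_ιMulti, map_smul, AlternatingMap.smul_apply, smul_eq_mul]
  simp only [apply_slot]
  field_simp
  linear_combination h

theorem linearIndependent_slot [FiniteDimensional F V] {ι : Type*} [Finite ι]
    (b : Basis ι F (Dual F V)) {ω : ⋀[F]^m V}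
    (hω : ∀ (m' : ℕ) (h : m = m' + 1) (A : Fin m' → ι) (B : Fin (m + 1) → ι),
      ∑ l : Fin (m + 1), (-1 : F) ^ (l : ℕ) *
        altForm m ω (Fin.snoc (α := fun _ => Dual F V) (b ∘ A) (b (B l)) ∘ Fin.cast h) *
        altForm m ω (b ∘ B ∘ l.succAbove) = 0)
    {K : Fin m → ι} (hK : altForm m ω (b ∘ K) ≠ 0) :
    LinearIndependent F (fun c => slot (b ∘ K) c ω) := by
  by_contra h
  have h1 := ιMulti_slot b hω hK
  rw [AlternatingMap.map_linearDependent _ _ h] at h1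
  have h2 : ω = 0 := (smul_eq_zero.1 h1.symm).resolve_left
    (mul_ne_zero (pow_ne_zero _ hK) (inv_ne_zero hK))
  exact hK (by simp [h2])

end PluckerPoints

section Points

variable {V : Type*} [AddCommGroup V] [Module ℂ V] {m : ℕ}

theorem exists_basis_of_finrank [FiniteDimensional ℂ V] {U : Submodule ℂ V}
    (hU : finrank ℂ U = m) : ∃ e : Basis (Fin m) ℂ U,
      LinearIndependent ℂ (fun a => (e a : V)) ∧
      Submodule.span ℂ (Set.range fun a => (e a : V)) = U := by
  refine ⟨finBasisOfFinrankEq ℂ U hU, ?_, ?_⟩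
  · exact (finBasisOfFinrankEq ℂ U hU).linearIndependent.map' U.subtype (by simp)
  · have h := congrArg (Submodule.map U.subtype) (finBasisOfFinrankEq ℂ U hU).span_eq
    rw [Submodule.map_span, ← Set.range_comp, Submodule.map_top, Submodule.range_subtype] at h
    exact h

/-- It suffices to test a Plücker point on one basis. -/
theorem isPluckerPoint_of_basis {P : ℙ ℂ (⋀[ℂ]^m V)} {u : Fin m → V}
    (hu : LinearIndependent ℂ u)
    (h : P.submodule = Submodule.span ℂ {exteriorPower.ιMulti ℂ m u}) :
    IsPluckerPoint P (Submodule.span ℂ (Set.range u)) := by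
  intro v hv hvu
  let e := Basis.span hu
  have hmem : ∀ a, v a ∈ Submodule.span ℂ (Set.range u) := fun a => by
    rw [← hvu]; exact Submodule.subset_span ⟨a, rfl⟩
  have h1 := ιMulti_eq_det_smul e fun a => ⟨v a, hmem a⟩
  have h2 : (fun a => (e a : V)) = u := by
    funext a; exact congrArg Subtype.val (Basis.span_apply hu a)
  rw [h2] at h1
  have h3 : e.det (fun a => ⟨v a, hmem a⟩) ≠ 0 := fun h0 => by
    rw [h0, zero_smul] at h1
    exact ιMulti_ne_zero hv h1
  rw [h]
  change _ = Submodule.span ℂ {exteriorPower.ιMulti ℂ m v}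
  have h4 : exteriorPower.ιMulti ℂ m v = _ := h1
  rw [h4, Submodule.span_singleton_smul_eq (IsUnit.mk0 _ h3)]

theorem isPluckerPoint_mk {ω : ⋀[ℂ]^m V} (hω : ω ≠ 0) {u : Fin m → V} {c : ℂ} (hc : c ≠ 0)
    (hu : LinearIndependent ℂ u) (h : exteriorPower.ιMulti ℂ m u = c • ω) :
    IsPluckerPoint (Projectivization.mk ℂ ω hω) (Submodule.span ℂ (Set.range u)) := by
  refine isPluckerPoint_of_basis hu ?_
  rw [Projectivization.submodule_mk, h, Submodule.span_singleton_smul_eq (IsUnit.mk0 _ hc)]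

theorem IsPluckerPoint.exists_eq_smul {ω : ⋀[ℂ]^m V} {hω : ω ≠ 0} {U : Submodule ℂ V}
    (h : IsPluckerPoint (Projectivization.mk ℂ ω hω) U) {u : Fin m → V}
    (hu : LinearIndependent ℂ u) (hU : Submodule.span ℂ (Set.range u) = U) :
    ∃ c : ℂ, c ≠ 0 ∧ ω = c • exteriorPower.ιMulti ℂ m u := by
  have h1 := h u hu hU
  rw [Projectivization.submodule_mk] at h1
  have h2 : ω ∈ Submodule.span ℂ {exteriorPower.ιMulti ℂ m u} := by
    rw [← h1]; exact Submodule.mem_span_singleton_self ω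
  obtain ⟨c, hc⟩ := Submodule.mem_span_singleton.1 h2
  refine ⟨c, fun h0 => hω ?_, hc.symm⟩
  rw [← hc, h0, zero_smul]

theorem IsPluckerPoint.exists_rep_eq_smul {P : ℙ ℂ (⋀[ℂ]^m V)} {U : Submodule ℂ V}
    (h : IsPluckerPoint P U) {u : Fin m → V}
    (hu : LinearIndependent ℂ u) (hU : Submodule.span ℂ (Set.range u) = U) :
    ∃ c : ℂ, c ≠ 0 ∧ P.rep = c • exteriorPower.ιMulti ℂ m u := by
  rw [← P.mk_rep] at h
  exact h.exists_eq_smul hu hU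

theorem exists_isPluckerPoint [FiniteDimensional ℂ V] {U : Submodule ℂ V}
    (hU : finrank ℂ U = m) : ∃ P : ℙ ℂ (⋀[ℂ]^m V), IsPluckerPoint P U := by
  obtain ⟨e, he, hs⟩ := exists_basis_of_finrank hU
  have h := isPluckerPoint_mk (ιMulti_ne_zero he) one_ne_zero he (one_smul _ _).symm
  rw [hs] at h
  exact ⟨_, h⟩

theorem IsPluckerPoint.unique [FiniteDimensional ℂ V] {U : Submodule ℂ V}
    (hU : finrank ℂ U = m) {P P' : ℙ ℂ (⋀[ℂ]^m V)} (h : IsPluckerPoint P U)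
    (h' : IsPluckerPoint P' U) : P = P' := by
  obtain ⟨e, he, hs⟩ := exists_basis_of_finrank hU
  exact Projectivization.submodule_injective ((h _ he hs).trans (h' _ he hs).symm)

/-- A subspace is determined by its Plücker point. -/
theorem IsPluckerPoint.mem_iff [FiniteDimensional ℂ V] {U : Submodule ℂ V}
    (hU : finrank ℂ U = m) {P : ℙ ℂ (⋀[ℂ]^m V)} (h : IsPluckerPoint P U) (y : V) :
    y ∈ U ↔ wedgeForm (altForm m P.rep) y = 0 := by
  obtain ⟨e, he, hs⟩ := exists_basis_of_finrank hU
  obtain ⟨c, hc, hP⟩ := h.exists_rep_eq_smul he hs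
  rw [hP, map_smul, wedgeForm_smul, smul_eq_zero, or_iff_right hc, wedgeForm_eq_zero_iff he, hs]

theorem IsPluckerPoint.subspace_unique [FiniteDimensional ℂ V] {U U' : Submodule ℂ V}
    (hU : finrank ℂ U = m) (hU' : finrank ℂ U' = m) {P : ℙ ℂ (⋀[ℂ]^m V)}
    (h : IsPluckerPoint P U) (h' : IsPluckerPoint P U') : U = U' := by
  ext y
  rw [h.mem_iff hU, h'.mem_iff hU']

end Points

/-! ### Polynomial maps and a criterion for isomorphy -/

section Varieties

variable {A B X Y : Type*} [AddCommGroup A] [Module ℂ A] [AddCommGroup B] [Module ℂ B]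

/-- A map of vector spaces is polynomial if its compositions with linear forms are. -/
def IsPolyMap (Φ : A → B) : Prop :=
  ∀ φ : Dual ℂ B, (fun a => φ (Φ a)) ∈ polyFun A

theorem dual_mem_polyFun (φ : Dual ℂ A) : (fun a => φ a) ∈ polyFun A :=
  Algebra.subset_adjoin ⟨φ, rfl⟩

theorem IsPolyMap.comp_mem {Φ : A → B} (hΦ : IsPolyMap Φ) {p : B → ℂ} (hp : p ∈ polyFun B) :
    (fun a => p (Φ a)) ∈ polyFun A := by
  induction hp using Algebra.adjoin_induction with
  | mem p hp => obtain ⟨φ, rfl⟩ := hp; exact hΦ φ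
  | algebraMap r => exact (polyFun A).algebraMap_mem r
  | add p q _ _ h1 h2 => exact (polyFun A).add_mem h1 h2
  | mul p q _ _ h1 h2 => exact (polyFun A).mul_mem h1 h2

theorem isPolyMap_linear (L : A →ₗ[ℂ] B) : IsPolyMap L := fun φ => dual_mem_polyFun (φ ∘ₗ L)

theorem IsPolyMap.continuous {Φ : A → B} (hΦ : IsPolyMap Φ) :
    Continuous[zariski A, zariski B] Φ := by
  refine continuous_generateFrom_iff.2 ?_
  rintro _ ⟨p, hp, rfl⟩
  exact TopologicalSpace.isOpen_generateFrom_of_mem ⟨_, hΦ.comp_mem hp, rfl⟩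

/-- A bijection covered by a polynomial map `Φ` and having local polynomial lifts `Ψ` in the
other direction is an isomorphism. -/
theorem isVarietyIso_of_lifts {S : Set A} {T : Set B} {π : S → X} {ρ : T → Y} {e : X ≃ Y}
    {Φ : A → B} (hΦ : IsPolyMap Φ) (hlift : ∀ s : S, ∃ h : Φ s ∈ T, ρ ⟨Φ s, h⟩ = e (π s))
    (hsec : ∀ x : T, ∃ q ∈ polyFun B, q x ≠ 0 ∧ ∃ Ψ : B → A, IsPolyMap Ψ ∧
      ∀ y : T, q y ≠ 0 → ∃ h : Ψ y ∈ S, e (π ⟨Ψ y, h⟩) = ρ y) :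
    IsVarietyIso π ρ e := by
  choose hT hρ using hlift
  choose q hq hqx Ψ hΨ hS using hsec
  constructor
  · intro U
    rw [isOpen_coinduced, isOpen_coinduced]
    constructor
    · rintro ⟨O, hO, hOU⟩
      refine ⟨Φ ⁻¹' O, @IsOpen.preimage _ _ (zariski A) (zariski B) _ hΦ.continuous _ hO, ?_⟩
      ext s
      have h1 := Set.ext_iff.1 hOU ⟨Φ s, hT s⟩
      simp only [Set.mem_preimage] at h1 ⊢
      rw [h1, hρ]
    · rintro ⟨O, hO, hOU⟩
      refine ⟨⋃ x : T, {b | q x b ≠ 0} ∩ Ψ x ⁻¹' O, ?_, ?_⟩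
      · refine @isOpen_iUnion _ _ (zariski B) _ fun x => @IsOpen.inter _ (zariski B) _ _ ?_ ?_
        · exact TopologicalSpace.isOpen_generateFrom_of_mem ⟨_, hq x, rfl⟩
        · exact @IsOpen.preimage _ _ (zariski B) (zariski A) _ (hΨ x).continuous _ hO
      · have key : ∀ x y : T, q x y ≠ 0 → (Ψ x y ∈ O ↔ ρ y ∈ U) := by
          intro x y hxy
          obtain ⟨h, he⟩ := hS x y hxy
          have h1 := Set.ext_iff.1 hOU ⟨Ψ x y, h⟩
          simp only [Set.mem_preimage] at h1
          rw [h1, he]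
        ext y
        simp only [Set.mem_preimage, Set.mem_iUnion, Set.mem_inter_iff, Set.mem_ofPred_eq]
        constructor
        · rintro ⟨x, hxy, hO⟩
          exact (key x y hxy).1 hO
        · intro hy
          exact ⟨y, hqx y, (key y y (hqx y)).2 hy⟩
  · intro U _ f
    constructor
    · intro hf s hs
      have hs' : ρ ⟨Φ s, hT s⟩ ∈ U := by rw [hρ]; exact hs
      obtain ⟨p, hp, r, hr, hrs, H⟩ := hf _ hs'
      refine ⟨_, hΦ.comp_mem hp, _, hΦ.comp_mem hr, hrs, fun y hy hry => ?_⟩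
      have h := H ⟨Φ y, hT y⟩ (by rw [hρ]; exact hy) hry
      rw [hρ] at h
      exact h
    · intro hf x hx
      obtain ⟨h, he⟩ := hS x x (hqx x)
      have hx' : π ⟨Ψ x x, h⟩ ∈ e ⁻¹' U := by rw [Set.mem_preimage, he]; exact hx
      obtain ⟨p, hp, r, hr, hrs, H⟩ := hf _ hx'
      -- the factor `q x` restricts the denominator to the locus where the lift `Ψ x` exists
      refine ⟨fun b => q x b * p (Ψ x b), (polyFun B).mul_mem (hq x) ((hΨ x).comp_mem hp),
        fun b => q x b * r (Ψ x b), (polyFun B).mul_mem (hq x) ((hΨ x).comp_mem hr),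
        mul_ne_zero (hqx x) hrs, fun y hy hry => ?_⟩
      have hqy : q x y ≠ 0 := left_ne_zero_of_mul hry
      obtain ⟨hy', hey⟩ := hS x y hqy
      have h := H ⟨Ψ x y, hy'⟩ (by rw [Set.mem_preimage, hey]; exact hy) (right_ne_zero_of_mul hry)
      rw [Function.comp_apply, hey] at h
      rw [h, mul_div_mul_left _ _ hqy]

/-- A multilinear form in linear functions of `a` is a polynomial function of `a`. -/
theorem multilinear_mem_polyFun {V : Type*} [AddCommGroup V] [Module ℂ V] [FiniteDimensional ℂ V]
    {m : ℕ} (f : MultilinearMap ℂ (fun _ : Fin m => V) ℂ) (L : Fin m → A →ₗ[ℂ] V) :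
    (fun a => f fun b => L b a) ∈ polyFun A := by
  let c := finBasis ℂ V
  have h : (fun a => f fun b => L b a) = ∑ r : Fin m → Fin (finrank ℂ V),
      (∏ b, fun a => (c.coord (r b) ∘ₗ L b) a) * algebraMap ℂ (A → ℂ) (f fun b => c (r b)) := by
    funext a
    have h1 : (fun b => L b a) = fun b => ∑ j, c.coord j (L b a) • c j := by
      funext b
      exact (c.sum_repr (L b a)).symm
    rw [h1, f.map_sum]
    simp [f.map_smul_univ, Finset.sum_apply, Finset.prod_apply]
  rw [h]
  exact (polyFun A).sum_mem fun r _ => (polyFun A).mul_mem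
    ((polyFun A).prod_mem fun b _ => dual_mem_polyFun _) ((polyFun A).algebraMap_mem _)

end Varieties

/-! ### Tuples of subspaces and tuples of Plücker points -/

section Correspondence

variable {n : ℕ} {V : Type*} [AddCommGroup V] [Module ℂ V] [FiniteDimensional ℂ V]

/-- If the Plücker coordinates of the subspaces `g_i⁻¹(U_i)` put a set `X` of tuples of subspaces in
bijection with a subset `Z` of a product of projective spaces, then this bijection is an
isomorphism of varieties: on the locus where a given coordinate of each factor is nonzero, bases of
the subspaces can be read off linearly from the coordinates. -/
theorem exists_isVarietyIso (α : Fin n → ℕ) (g : Fin n → V ≃ₗ[ℂ] V)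
    (X : Set (Fin n → Submodule ℂ V)) (Z : Set (∀ i, ℙ ℂ (⋀[ℂ]^(α i) V)))
    (hX : ∀ U ∈ X, ∀ i, finrank ℂ (U i) = α i)
    (hXZ : ∀ U ∈ X, ∀ P : ∀ i, ℙ ℂ (⋀[ℂ]^(α i) V),
      (∀ i, IsPluckerPoint (P i) ((U i).comap (g i : V →ₗ[ℂ] V))) → P ∈ Z)
    (hZ : ∀ P ∈ Z, ∀ i, ∃ W : Submodule ℂ V, finrank ℂ W = α i ∧ IsPluckerPoint (P i) W)
    (hZX : ∀ P ∈ Z, ∀ U : Fin n → Submodule ℂ V, (∀ i, finrank ℂ (U i) = α i) →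
      (∀ i, IsPluckerPoint (P i) ((U i).comap (g i : V →ₗ[ℂ] V))) → U ∈ X) :
    ∃ e : X ≃ Z, IsVarietyIso (framesMap α X) (projConeMap Z) e ∧
      ∀ (U : X) (i : Fin n), IsPluckerPoint ((e U).1 i) ((U.1 i).comap (g i : V →ₗ[ℂ] V)) := by
  have hcomap : ∀ i (U : Submodule ℂ V),
      finrank ℂ (U.comap (g i : V →ₗ[ℂ] V)) = finrank ℂ U := fun i U => by
    rw [Submodule.comap_equiv_eq_map_symm]
    exact LinearEquiv.finrank_map_eq (g i).symm U
  have hmap : ∀ i (U : Submodule ℂ V), (U.map (g i : V →ₗ[ℂ] V)).comap (g i : V →ₗ[ℂ] V) = U :=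
    fun i U => Submodule.comap_map_eq_of_injective (g i).injective U
  have hex : ∀ U : X, ∃ P : Z, ∀ i,
      IsPluckerPoint (P.1 i) ((U.1 i).comap (g i : V →ₗ[ℂ] V)) := fun U => by
    choose P hP using fun i => exists_isPluckerPoint ((hcomap i _).trans (hX U.1 U.2 i))
    exact ⟨⟨P, hXZ U.1 U.2 P hP⟩, hP⟩
  choose f hf using hex
  have hinj : Function.Injective f := by
    intro U U' h
    apply Subtype.ext
    funext i
    have h1 := hf U' i
    rw [← h] at h1
    have h2 := (hf U i).subspace_unique ((hcomap i _).trans (hX U.1 U.2 i))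
      ((hcomap i _).trans (hX U'.1 U'.2 i)) h1
    exact Submodule.comap_injective_of_surjective (g i).surjective h2
  have hsurj : Function.Surjective f := by
    intro P
    choose W hW hPW using hZ P.1 P.2
    have hr : ∀ i, finrank ℂ ((W i).map (g i : V →ₗ[ℂ] V)) = α i := fun i => by
      rw [← hW i]; exact LinearEquiv.finrank_map_eq (g i) (W i)
    have hU : (fun i => (W i).map (g i : V →ₗ[ℂ] V)) ∈ X :=
      hZX P.1 P.2 _ hr fun i => by rw [hmap]; exact hPW i
    refine ⟨⟨_, hU⟩, Subtype.ext (funext fun i => ?_)⟩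
    have h1 := hf ⟨_, hU⟩ i
    simp only [hmap] at h1
    exact h1.unique (hW i) (hPW i)
  let e := Equiv.ofBijective f ⟨hinj, hsurj⟩
  refine ⟨e, ?_, hf⟩
  let b := (finBasis ℂ V).dualBasis
  refine isVarietyIso_of_lifts
    (Φ := fun u i => exteriorPower.ιMulti ℂ (α i) fun a => (g i).symm (u i a)) ?_ ?_ ?_
  · -- every form in the wedge products is a sum of multilinear forms in the bases
    intro φ
    have h1 : (fun u : (∀ i, Fin (α i) → V) => φ fun i =>
        exteriorPower.ιMulti ℂ (α i) fun a => (g i).symm (u i a)) =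
        ∑ i, fun u => (((φ ∘ₗ LinearMap.single ℂ _ i).compAlternatingMap
          (exteriorPower.ιMulti ℂ (α i))).toMultilinearMap) fun a =>
            (((g i).symm : V →ₗ[ℂ] V) ∘ₗ (LinearMap.proj a ∘ₗ LinearMap.proj i :
              (∀ i, Fin (α i) → V) →ₗ[ℂ] V)) u := by
      funext u
      rw [Finset.sum_apply]
      conv_lhs => rw [← Finset.univ_sum_single (fun i =>
        exteriorPower.ιMulti ℂ (α i) fun a => (g i).symm (u i a)), map_sum]
      rfl
    rw [h1]
    exact (polyFun _).sum_mem fun i _ => multilinear_mem_polyFun _ _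
  · intro s
    have hU := s.2.2
    have hli : ∀ i, LinearIndependent ℂ fun a => (g i).symm (s.1 i a) := fun i =>
      (s.2.1 i).map' ((g i).symm : V →ₗ[ℂ] V) (LinearEquiv.ker _)
    have hsp : ∀ i, Submodule.span ℂ (Set.range fun a => (g i).symm (s.1 i a)) =
        ((framesMap α X s).1 i).comap (g i : V →ₗ[ℂ] V) := fun i => by
      rw [Submodule.comap_equiv_eq_map_symm]
      change _ = Submodule.map _ (Submodule.span ℂ (Set.range (s.1 i)))
      rw [Submodule.map_span, ← Set.range_comp]
      rfl
    have hne := fun i => ιMulti_ne_zero (hli i)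
    have hpt : (fun i => Projectivization.mk ℂ _ (hne i)) = (e (framesMap α X s)).1 := by
      funext i
      have h1 := isPluckerPoint_mk (hne i) one_ne_zero (hli i) (one_smul _ _).symm
      rw [hsp] at h1
      exact h1.unique ((hcomap i _).trans (hX _ hU i)) (hf (framesMap α X s) i)
    refine ⟨⟨hne, ?_⟩, Subtype.ext hpt⟩
    rw [hpt]
    exact (e (framesMap α X s)).2
  · intro x
    have hx : ∀ i, ∃ K : Fin (α i) → Fin (finrank ℂ V), altForm (α i) (x.1 i) (b ∘ K) ≠ 0 :=
      fun i => exists_basis_ne_zero b fun h => (x.2.choose i)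
        (altForm_injective (h.trans (map_zero _).symm))
    choose K hK using hx
    refine ⟨fun w => ∏ i, altForm (α i) (w i) (b ∘ K i), ?_,
      Finset.prod_ne_zero_iff.2 fun i _ => hK i,
      LinearMap.pi fun i => LinearMap.pi fun c => (g i : V →ₗ[ℂ] V) ∘ₗ slot (b ∘ K i) c ∘ₗ
        LinearMap.proj i, isPolyMap_linear _, ?_⟩
    · have h1 : (fun w : (∀ i, ⋀[ℂ]^(α i) V) => ∏ i, altForm (α i) (w i) (b ∘ K i)) =
          ∏ i, fun w => altForm (α i) (w i) (b ∘ K i) := by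
        funext w; rw [Finset.prod_apply]
      rw [h1]
      refine (polyFun _).prod_mem fun i _ => ?_
      simp only [altForm_apply]
      exact dual_mem_polyFun ((exteriorPower.pairingDual ℂ V (α i)
        (exteriorPower.ιMulti ℂ (α i) (b ∘ K i))) ∘ₗ
          (LinearMap.proj i : (∀ i, ⋀[ℂ]^(α i) V) →ₗ[ℂ] ⋀[ℂ]^(α i) V))
    · -- `g_i` maps the slots of `y_i` to a basis of the subspace with Plücker point `[y_i]`
      intro y hy
      have hy' : ∀ i, altForm (α i) (y.1 i) (b ∘ K i) ≠ 0 := fun i =>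
        Finset.prod_ne_zero_iff.1 hy i (Finset.mem_univ i)
      obtain ⟨U, hU⟩ := hsurj (projConeMap Z y)
      have hyU := hf U
      rw [hU] at hyU
      have hpl : ∀ i (m' : ℕ) (h : α i = m' + 1) (A : Fin m' → Fin (finrank ℂ V))
          (B : Fin (α i + 1) → Fin (finrank ℂ V)),
          ∑ l : Fin (α i + 1), (-1 : ℂ) ^ (l : ℕ) * altForm (α i) (y.1 i)
              (Fin.snoc (α := fun _ => Dual ℂ V) (b ∘ A) (b (B l)) ∘ Fin.cast h) *
            altForm (α i) (y.1 i) (b ∘ B ∘ l.succAbove) = 0 := fun i m' h A B => by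
        obtain ⟨v, hv, hs⟩ := exists_basis_of_finrank ((hcomap i _).trans (hX U.1 U.2 i))
        obtain ⟨c, -, hc⟩ := (hyU i).exists_eq_smul hv hs
        exact plucker_of_decomposable hc m' h (b ∘ A) (b ∘ B)
      have hli := fun i => linearIndependent_slot b (hpl i) (hy' i)
      have hpt := fun i => isPluckerPoint_mk (y.2.choose i)
        (mul_ne_zero (pow_ne_zero _ (hy' i)) (inv_ne_zero (hy' i))) (hli i)
        (ιMulti_slot b (hpl i) (hy' i))
      have hspan : ∀ i, Submodule.span ℂ (Set.range fun c => g i (slot (b ∘ K i) c (y.1 i))) =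
          U.1 i := fun i => by
        have h1 := (hpt i).subspace_unique (by simpa using finrank_span_eq_card (hli i))
          ((hcomap i _).trans (hX U.1 U.2 i)) (hyU i)
        have h2 := congrArg (Submodule.map (g i : V →ₗ[ℂ] V)) h1
        rw [Submodule.map_comap_eq_of_surjective (g i).surjective, Submodule.map_span,
          ← Set.range_comp] at h2
        exact h2
      have hfr : (fun i => Submodule.span ℂ
          (Set.range fun c => g i (slot (b ∘ K i) c (y.1 i)))) = U.1 := funext hspan
      refine ⟨⟨fun i => (hli i).map' (g i : V →ₗ[ℂ] V) (LinearEquiv.ker _), ?_⟩, ?_⟩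
      · change (fun i => Submodule.span ℂ
          (Set.range fun c => g i (slot (b ∘ K i) c (y.1 i)))) ∈ X
        rw [hfr]
        exact U.2
      · change f _ = _
        rw [← hU]
        congr 1
        exact Subtype.ext hfr

end Correspondence

/-! ### Subspaces invariant under a nilpotent operator -/

section Nilpotent

variable {F V : Type*} [Field F] [AddCommGroup V] [Module F V] {m : ℕ}

theorem det_one_add_of_isNilpotent {W : Type*} [AddCommGroup W] [Module F W]
    [FiniteDimensional F W] {f : End F W} (hf : IsNilpotent f) : LinearMap.det (1 + f) = 1 := by
  have h1 := f.eval_charpoly (-1)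
  rw [hf.charpoly_eq_X_pow_finrank, Polynomial.eval_pow, Polynomial.eval_X] at h1
  have h2 : algebraMap F (End F W) (-1) - f = (-1 : F) • (1 + f) := by
    rw [map_neg, map_one, smul_add, neg_one_smul, neg_one_smul, sub_eq_add_neg]
  rw [h2, LinearMap.det_smul] at h1
  have h3 : (-1 : F) ^ finrank F W ≠ 0 := pow_ne_zero _ (neg_ne_zero.2 one_ne_zero)
  exact mul_left_cancel₀ h3 (h1.symm.trans (mul_one _).symm)

/-- The kernels of the powers of a nilpotent operator grow strictly until they are everything. -/
theorem le_finrank_ker_pow {W : Type*} [AddCommGroup W] [Module F W]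
    [FiniteDimensional F W] {f : End F W} (hf : IsNilpotent f) (k : ℕ) (hk : k ≤ finrank F W) :
    k ≤ finrank F (LinearMap.ker (f ^ k)) := by
  induction k with
  | zero => simp
  | succ k ih =>
    by_cases h : LinearMap.ker (f ^ k) = LinearMap.ker (f ^ (k + 1))
    · obtain ⟨d, hd⟩ := hf
      have h1 := End.ker_pow_constant h d
      rw [pow_add, hd, mul_zero, LinearMap.ker_zero] at h1
      have h2 : LinearMap.ker (f ^ (k + 1)) = ⊤ := h ▸ h1
      rw [h2, finrank_top]
      exact hk
    · have hle : LinearMap.ker (f ^ k) ≤ LinearMap.ker (f ^ (k + 1)) := by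
        rw [pow_succ']
        exact LinearMap.ker_le_ker_comp _ _
      have := Submodule.finrank_lt_finrank_of_lt (lt_of_le_of_ne hle h)
      have := ih (by omega)
      omega

variable {N : End F V} {u : Fin m → V}

theorem map_mem_span_of_basis (h : ∀ a, N (u a) ∈ Submodule.span F (Set.range u)) :
    ∀ x ∈ Submodule.span F (Set.range u), N x ∈ Submodule.span F (Set.range u) := by
  intro x hx
  have h1 : Submodule.span F (Set.range u) ≤ (Submodule.span F (Set.range u)).comap N :=
    Submodule.span_le.2 (by rintro _ ⟨a, rfl⟩; exact h a)
  exact h1 hx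

theorem isNilpotent_restrict (hN : IsNilpotent N) {U : Submodule F V} (h : ∀ x ∈ U, N x ∈ U) :
    IsNilpotent (N.restrict h) := by
  obtain ⟨d, hd⟩ := hN
  refine ⟨d, ?_⟩
  rw [End.pow_restrict]
  ext x
  simp [hd]

/-- The unipotent operator `1 + N` fixes the wedge product of an invariant subspace. -/
theorem ιMulti_one_add (hN : IsNilpotent N) (hu : LinearIndependent F u)
    (h : ∀ a, N (u a) ∈ Submodule.span F (Set.range u)) :
    exteriorPower.ιMulti F m (fun a => u a + N (u a)) = exteriorPower.ιMulti F m u := by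
  have hinv := map_mem_span_of_basis h
  let e := Basis.span hu
  have : FiniteDimensional F (Submodule.span F (Set.range u)) := Module.Finite.of_basis e
  have he : ∀ a, (e a : V) = u a := fun a => congrArg Subtype.val (Basis.span_apply hu a)
  have h1 := ιMulti_eq_det_smul e ((1 + N.restrict hinv : End F _) ∘ e)
  rw [Basis.det_comp, det_one_add_of_isNilpotent (isNilpotent_restrict hN hinv), Basis.det_self,
    mul_one, one_smul] at h1
  simpa [he] using h1

/-- A minor of an invariant subspace vanishes if too many of its functionals factor through a
power of `N`: they vanish on the kernel of that power, which is too big. -/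
theorem altForm_eq_zero_of_factor (hN : IsNilpotent N) (hu : LinearIndependent F u)
    (h : ∀ a, N (u a) ∈ Submodule.span F (Set.range u)) (ψ : Fin m → Dual F V) (j : Fin m)
    (hψ : ∀ a, j ≤ a → ∃ χ : Dual F V, ψ a = χ ∘ₗ N ^ (j + 1 : ℕ)) :
    altForm m (exteriorPower.ιMulti F m u) ψ = 0 := by
  have hinv := map_mem_span_of_basis h
  have : FiniteDimensional F (Submodule.span F (Set.range u)) :=
    Module.Finite.of_basis (Basis.span hu)
  have hd : finrank F (Submodule.span F (Set.range u)) = m := by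
    simpa using finrank_span_eq_card hu
  have hk := le_finrank_ker_pow (isNilpotent_restrict hN hinv) (j + 1) (by rw [hd]; exact j.2)
  -- the functionals with index below `j` are too few to be injective on the kernel
  let G : LinearMap.ker (N.restrict hinv ^ (j + 1 : ℕ)) →ₗ[F] (Fin (j : ℕ) → F) :=
    LinearMap.pi fun a => ψ (a.castLE j.2.le) ∘ₗ Submodule.subtype _ ∘ₗ Submodule.subtype _
  obtain ⟨x, hx, hx0⟩ := (Submodule.ne_bot_iff _).1 (LinearMap.ker_ne_bot_of_finrank_lt (f := G)
    (by rw [finrank_fin_fun]; omega))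
  have hxa : ∀ a, ψ a x.1.1 = 0 := by
    intro a
    rcases lt_or_ge a j with ha | ha
    · exact congrFun hx ⟨a, ha⟩
    · obtain ⟨χ, hχ⟩ := hψ a ha
      have h1 : ((N.restrict hinv ^ (j + 1 : ℕ)) x.1).1 = 0 := by
        have := x.2
        rw [LinearMap.mem_ker] at this
        rw [this]; rfl
      have h2 : ∀ y, ((N.restrict hinv ^ (j + 1 : ℕ)) y).1 = (N ^ (j + 1 : ℕ)) y.1 := fun y => by
        rw [End.pow_restrict]; rfl
      rw [hχ, LinearMap.comp_apply, ← h2, h1, map_zero]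
  obtain ⟨c, hc⟩ := (Submodule.mem_span_range_iff_exists_fun F).1 x.1.2
  rw [altForm_ιMulti]
  refine Matrix.exists_vecMul_eq_zero_iff.1 ⟨c, fun h0 => hx0 ?_, ?_⟩
  · apply Subtype.ext
    apply Subtype.ext
    rw [← hc, h0]
    simp
  · funext a
    have := hxa a
    rw [← hc, map_sum] at this
    simpa [Matrix.vecMul, dotProduct] using this

theorem altForm_ιMulti_comp (f : End F V) (v : Fin m → V) (ψ : Fin m → Dual F V) :
    altForm m (exteriorPower.ιMulti F m v) (fun a => ψ a ∘ₗ f) =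
      altForm m (exteriorPower.ιMulti F m (fun b => f (v b))) ψ := by
  rw [altForm_ιMulti, altForm_ιMulti]
  rfl

end Nilpotent

/-! ### Coordinates on `J` -/

section Coordinates

variable {n : ℕ} {ζ : Fin n → ℕ} {lam : ℂ} {M m : ℕ}

instance : FiniteDimensional ℂ (J ζ lam M) := Module.Finite.of_basis (basisJ ζ lam M)

theorem comp_diffOnJ (S : Finset (Fin n)) (g : J ζ lam M) (c : Comp ζ) :
    comp ζ c (diffOnJ ζ lam M S g).1 =
      if c.1 ∈ S then D (comp ζ c g.1) else comp ζ c g.1 := by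
  change comp ζ c (diffOn ζ S g.1) = _
  rw [diffOn, comp_ofComps]
  split_ifs <;> rfl

theorem J_ext {g h : J ζ lam M} (H : ∀ c, comp ζ c g.1 = comp ζ c h.1) : g = h :=
  Subtype.ext (VecFun.ext H)

/-- The operator `d/dt - lam` on `J`; it maps `e_{q,r,s+1}` to `e_{q,r,s}`. -/
def shift (ζ : Fin n → ℕ) (lam : ℂ) (M : ℕ) : End ℂ (J ζ lam M) :=
  diffOnJ ζ lam M Finset.univ - lam • 1

theorem comp_shift_pow (k : ℕ) (g : J ζ lam M) (c : Comp ζ) :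
    comp ζ c ((shift ζ lam M ^ k) g).1 =
      ((D - lam • (1 : End ℂ Entire)) ^ k) (comp ζ c g.1) := by
  induction k generalizing g with
  | zero => simp
  | succ k ih =>
    rw [pow_succ, pow_succ, End.mul_apply, End.mul_apply, ih]
    congr 1
    have h := comp_diffOnJ Finset.univ g c
    rw [if_pos (Finset.mem_univ _)] at h
    simp [shift, h]

theorem shift_pow_eq_zero : shift ζ lam M ^ M = 0 := by
  refine LinearMap.ext fun g => J_ext fun c => ?_
  have h : ((ddt ζ - lam • (1 : End ℂ (VecFun ζ))) ^ M) g.1 = 0 := g.2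
  rw [comp_shift_pow, ← ddt_sub_pow_apply, h]
  simp

theorem isNilpotent_shift : IsNilpotent (shift ζ lam M) := ⟨M, shift_pow_eq_zero⟩

/-- The coordinates of `g` are initial values, also when the index is out of range. -/
theorem coordFn_apply (k : Idx ζ) (g : J ζ lam M) :
    coordFn ζ lam M k g =
      (((D - lam • (1 : End ℂ Entire)) ^ k.2) (comp ζ k.1 g.1)).toFun 0 := by
  classical
  by_cases h : k.2 < M
  · have h1 : (basisJ ζ lam M).coord (k.1, ⟨k.2, h⟩) =
        LinearMap.proj (k.1, ⟨k.2, h⟩) ∘ₗ initialValues ζ lam M := by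
      refine (basisJ ζ lam M).ext fun l => ?_
      have h2 : basisJ ζ lam M l = basisVec ζ lam M l := Basis.mk_apply _ _ _
      rw [LinearMap.comp_apply, LinearMap.proj_apply, h2, initialValues_basisVec, ← h2,
        Basis.coord_apply, Basis.repr_self, Finsupp.single_apply, Pi.single_apply]
      simp [eq_comm]
    rw [coordFn, dif_pos h, h1]
    rfl
  · rw [coordFn, dif_neg h, ← comp_shift_pow, pow_eq_zero_of_le (not_lt.1 h) shift_pow_eq_zero]
    simp

/-- Raising the third entry of an index amounts to applying `d/dt - lam` first. -/
theorem coordFn_add (k : Idx ζ) (j : ℕ) :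
    coordFn ζ lam M (k.1, k.2 + j) = coordFn ζ lam M k ∘ₗ shift ζ lam M ^ j := by
  refine LinearMap.ext fun g => ?_
  rw [LinearMap.comp_apply, coordFn_apply, coordFn_apply, comp_shift_pow, pow_add, End.mul_apply]

/-- For `lam = 0` the operation `k ↦ k'` on indices is dual to the arrow at `i`. -/
theorem coordFn_prime (i : Fin n) (k : Idx ζ) :
    coordFn ζ 0 M (prime i k) = coordFn ζ 0 M k ∘ₗ diffOnJ ζ 0 M {i} := by
  refine LinearMap.ext fun g => ?_
  rw [LinearMap.comp_apply, coordFn_apply, coordFn_apply, comp_diffOnJ, prime]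
  by_cases h : k.1.1 = i
  · simp [h, pow_succ]
  · simp [h]

/-- The basis of the dual space of `J` consisting of the coordinate functionals. -/
def dualBasisJ (ζ : Fin n → ℕ) (lam : ℂ) (M : ℕ) :
    Basis (Comp ζ × Fin M) ℂ (Dual ℂ (J ζ lam M)) := by
  classical exact (basisJ ζ lam M).dualBasis

/-- A triple with `s < M` as a triple with arbitrary `s`. -/
def toIdx (k : Comp ζ × Fin M) : Idx ζ := (k.1, k.2)

theorem dualBasisJ_apply (k : Comp ζ × Fin M) :
    dualBasisJ ζ lam M k = coordFn ζ lam M (toIdx k) := by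
  classical
  rw [dualBasisJ, Basis.coe_dualBasis, coordFn, dif_pos (show (toIdx k).2 < M from k.2.2)]
  rfl

theorem plk_eq_altForm (ω : ⋀[ℂ]^m (J ζ lam M)) (K : Fin m → Idx ζ) :
    plk ω K = altForm m ω (fun a => coordFn ζ lam M (K a)) :=
  (altForm_apply _ _).symm

theorem plk_toIdx (ω : ⋀[ℂ]^m (J ζ lam M)) (K : Fin m → Comp ζ × Fin M) :
    plk ω (fun a => toIdx (K a)) = altForm m ω (dualBasisJ ζ lam M ∘ K) := by
  rw [plk_eq_altForm]
  congr 1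
  funext a
  exact (dualBasisJ_apply _).symm

theorem plk_snoc (ω : ⋀[ℂ]^m (J ζ lam M)) {m' : ℕ} (h : m = m' + 1) (A : Fin m' → Idx ζ)
    (k : Idx ζ) :
    plk ω (Fin.snoc (α := fun _ => Idx ζ) A k ∘ Fin.cast h) =
      altForm m ω (Fin.snoc (α := fun _ => Dual ℂ (J ζ lam M))
        (fun a => coordFn ζ lam M (A a)) (coordFn ζ lam M k) ∘ Fin.cast h) := by
  subst h
  rw [plk_eq_altForm]
  congr 1
  funext a
  refine Fin.lastCases ?_ (fun a => ?_) a <;> simp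

/-! ### The equations in terms of subspaces -/

theorem pluckerEqs_of_decomposable {ω : ⋀[ℂ]^m (J ζ lam M)} {c : ℂ} {u : Fin m → J ζ lam M}
    (hω : ω = c • exteriorPower.ιMulti ℂ m u) : PluckerEqs ω := by
  intro m' h A B
  have h1 := plucker_of_decomposable hω m' h (fun a => coordFn ζ lam M (A a))
    (fun l => coordFn ζ lam M (B l))
  simp only [plk_snoc]
  simp only [plk_eq_altForm]
  exact h1

/-- A solution of the Plücker equations is the Plücker point of a subspace spanned by slots. -/
theorem PluckerEqs.exists_slot {P : ℙ ℂ (⋀[ℂ]^m (J ζ lam M))} (h : PluckerEqs P.rep) :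
    ∃ K : Fin m → Comp ζ × Fin M,
      LinearIndependent ℂ (fun c => slot (dualBasisJ ζ lam M ∘ K) c P.rep) ∧
      IsPluckerPoint P (Submodule.span ℂ
        (Set.range fun c => slot (dualBasisJ ζ lam M ∘ K) c P.rep)) := by
  obtain ⟨K, hK⟩ := exists_basis_ne_zero (dualBasisJ ζ lam M) (P := altForm m P.rep)
    fun h0 => P.rep_nonzero (altForm_injective (h0.trans (map_zero _).symm))
  have hpl : ∀ (m' : ℕ) (h : m = m' + 1) (A : Fin m' → Comp ζ × Fin M)
      (B : Fin (m + 1) → Comp ζ × Fin M),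
      ∑ l : Fin (m + 1), (-1 : ℂ) ^ (l : ℕ) * altForm m P.rep
          (Fin.snoc (α := fun _ => Dual ℂ (J ζ lam M)) (dualBasisJ ζ lam M ∘ A)
            (dualBasisJ ζ lam M (B l)) ∘ Fin.cast h) *
        altForm m P.rep (dualBasisJ ζ lam M ∘ B ∘ l.succAbove) = 0 := fun m' hm A B => by
    have h1 := h m' hm (fun a => toIdx (A a)) (fun l => toIdx (B l))
    simp only [plk_snoc] at h1
    simp only [plk_eq_altForm, Function.comp_apply, ← dualBasisJ_apply] at h1
    exact h1
  have hli := linearIndependent_slot _ hpl hK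
  refine ⟨K, hli, ?_⟩
  have h1 := isPluckerPoint_mk P.rep_nonzero
    (mul_ne_zero (pow_ne_zero _ hK) (inv_ne_zero hK)) hli (ιMulti_slot _ hpl hK)
  rwa [P.mk_rep] at h1

/-- Expanding `1 + N` in every argument, the shift equations say that `⋀(1 + N)` fixes `ω`. -/
theorem shiftEqs_iff {ω : ⋀[ℂ]^m (J ζ lam M)} :
    ShiftEqs ω ↔ ∀ K : Fin m → Idx ζ,
      altForm m ω (fun a => coordFn ζ lam M (K a) ∘ₗ (1 + shift ζ lam M)) =
        altForm m ω (fun a => coordFn ζ lam M (K a)) := by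
  refine forall_congr' fun K => ?_
  have h1 : (fun a => coordFn ζ lam M (K a) ∘ₗ (1 + shift ζ lam M)) =
      (fun a => coordFn ζ lam M ((K a).1, (K a).2 + 1)) + fun a => coordFn ζ lam M (K a) := by
    funext a
    rw [Pi.add_apply, coordFn_add, pow_one, add_comm, LinearMap.comp_add]
    rfl
  have h2 : ∀ E : Finset (Fin m), plk ω (fun a => if a ∈ E then ((K a).1, (K a).2 + 1) else K a) =
      altForm m ω (E.piecewise (fun a => coordFn ζ lam M ((K a).1, (K a).2 + 1))
        fun a => coordFn ζ lam M (K a)) := fun E => by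
    rw [plk_eq_altForm]
    congr 1
    funext a
    by_cases ha : a ∈ E <;> simp [ha]
  rw [h1, AlternatingMap.map_add_univ]
  simp only [h2]
  have h3 : (Finset.univ : Finset (Finset (Fin m))).filter (fun E => E.Nonempty) =
      Finset.univ.erase ∅ := by
    ext E; simp [Finset.nonempty_iff_ne_empty]
  rw [h3, ← Finset.add_sum_erase _ _ (Finset.mem_univ (∅ : Finset (Fin m))),
    Finset.piecewise_empty]
  exact left_eq_add.symm.trans eq_comm

/-- The vector of an invariant subspace satisfies the equations (a). -/
theorem eqs_of_invariant {ω : ⋀[ℂ]^m (J ζ lam M)} {c : ℂ} {u : Fin m → J ζ lam M}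
    (hω : ω = c • exteriorPower.ιMulti ℂ m u) (hu : LinearIndependent ℂ u)
    (h : ∀ a, shift ζ lam M (u a) ∈ Submodule.span ℂ (Set.range u)) :
    PluckerEqs ω ∧ VanishingEqs ω ∧ ShiftEqs ω := by
  refine ⟨pluckerEqs_of_decomposable hω, ?_, ?_⟩
  · rintro K hK ⟨j, hj⟩
    rw [plk_eq_altForm, hω, map_smul, AlternatingMap.smul_apply,
      altForm_eq_zero_of_factor isNilpotent_shift hu h _ j, smul_zero]
    intro a ha
    have h1 : (j : ℕ) + 1 ≤ (K a).2 := lt_of_lt_of_le hj (hK ha)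
    refine ⟨coordFn ζ lam M ((K a).1, (K a).2 - (j + 1)), ?_⟩
    rw [← coordFn_add, Nat.sub_add_cancel h1]
  · refine shiftEqs_iff.2 fun K => ?_
    rw [hω, map_smul, AlternatingMap.smul_apply, AlternatingMap.smul_apply, altForm_ιMulti_comp]
    have h1 : (fun b => (1 + shift ζ lam M) (u b)) = fun b => u b + shift ζ lam M (u b) := by
      funext b; simp
    rw [h1, ιMulti_one_add isNilpotent_shift hu h]

theorem ShiftEqs.invariant {ω : ⋀[ℂ]^m (J ζ lam M)} (hS : ShiftEqs ω) {c : ℂ} (hc : c ≠ 0)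
    {u : Fin m → J ζ lam M} (hω : ω = c • exteriorPower.ιMulti ℂ m u)
    (hu : LinearIndependent ℂ u) :
    ∀ x ∈ Submodule.span ℂ (Set.range u),
      shift ζ lam M x ∈ Submodule.span ℂ (Set.range u) := by
  have h1 : altForm m (exteriorPower.ιMulti ℂ m fun a => (1 + shift ζ lam M) (u a)) =
      altForm m (exteriorPower.ιMulti ℂ m u) := by
    refine Basis.ext_alternating (dualBasisJ ζ lam M) fun K _ => ?_
    have h2 := shiftEqs_iff.1 hS fun a => toIdx (K a)
    rw [hω, map_smul, AlternatingMap.smul_apply, AlternatingMap.smul_apply,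
      altForm_ιMulti_comp] at h2
    simp only [← dualBasisJ_apply] at h2
    exact smul_right_injective _ hc h2
  refine map_mem_span_of_basis fun a => ?_
  have h3 : (1 + shift ζ lam M) (u a) ∈ Submodule.span ℂ (Set.range u) := by
    rw [← wedgeForm_eq_zero_iff hu, ← h1]
    exact wedgeForm_eq_zero_of_mem (Submodule.subset_span ⟨a, rfl⟩)
  have h4 := Submodule.sub_mem _ h3 (Submodule.subset_span (Set.mem_range_self a))
  simpa using h4

/-- The vanishing equations kill all coordinates with a large third entry. -/
theorem VanishingEqs.eq_zero_of_le {ω : ⋀[ℂ]^m (J ζ lam M)} (hV : VanishingEqs ω)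
    (K : Fin m → Idx ζ) (a : Fin m) (ha : m ≤ (K a).2) : plk ω K = 0 := by
  -- in the sorted tuple the last entry is at least `m`
  let σ := Tuple.sort fun a => (K a).2
  have hσ : Monotone fun a => (K (σ a)).2 := Tuple.monotone_sort fun a => (K a).2
  have hm : 0 < m := a.pos
  have h1 : plk ω (K ∘ σ) = 0 := by
    refine hV _ hσ ⟨⟨m - 1, by omega⟩, ?_⟩
    have h2 : (K (σ (σ.symm a))).2 ≤ (K (σ ⟨m - 1, by omega⟩)).2 :=
      hσ (Fin.le_def.2 (by have := (σ.symm a).2; change (σ.symm a : ℕ) ≤ m - 1; omega))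
    rw [Equiv.apply_symm_apply] at h2
    change m - 1 < (K (σ ⟨m - 1, _⟩)).2
    omega
  rw [plk_eq_altForm] at h1 ⊢
  have h3 := (altForm m ω).map_perm (fun a => coordFn ζ lam M (K a)) σ
  have h4 : (altForm m ω) ((fun a => coordFn ζ lam M (K a)) ∘ σ) = 0 := h1
  rw [h4] at h3
  exact (smul_eq_zero_iff_eq _).1 h3.symm

/-- Moving the argument in place `b` to the end. -/
theorem map_update_eq_snoc {E : Type*} [AddCommGroup E] [Module ℂ E]
    (P : E [⋀^Fin (m + 1)]→ₗ[ℂ] ℂ) (φ : Fin (m + 1) → E) (b : Fin (m + 1)) (ψ : E) :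
    P (Function.update φ b ψ) = (-1) ^ (b : ℕ) * (-1) ^ m *
      P (Fin.snoc (α := fun _ => E) (b.removeNth φ) ψ) := by
  have h1 := P.map_insertNth b ψ (b.removeNth φ)
  have h2 := P.neg_one_pow_smul_map_insertNth (Fin.last m) ψ (b.removeNth φ)
  rw [← h2, Fin.insertNth_removeNth, Fin.insertNth_last', Fin.val_last] at h1
  rw [h1]
  rcases Nat.even_or_odd (b : ℕ) with hb | hb <;> rcases Nat.even_or_odd m with hm | hm <;>
    simp [hb.neg_one_pow, hm.neg_one_pow]

/-- The equations (c) for one arrow hold if the arrow maps one subspace to the other: the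
equations express that the images of the contractions of `ω` lie in the second subspace. -/
theorem incidence_of_map_mem {m₁ m₂ : ℕ} {ω₁ : ⋀[ℂ]^m₁ (J ζ 0 M)} {ω₂ : ⋀[ℂ]^m₂ (J ζ 0 M)}
    {c₁ c₂ : ℂ} {u₁ : Fin m₁ → J ζ 0 M} {u₂ : Fin m₂ → J ζ 0 M}
    (h₁ : ω₁ = c₁ • exteriorPower.ιMulti ℂ m₁ u₁) (h₂ : ω₂ = c₂ • exteriorPower.ιMulti ℂ m₂ u₂)
    (i : Fin n) (h : ∀ x ∈ Submodule.span ℂ (Set.range u₁),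
      diffOnJ ζ 0 M {i} x ∈ Submodule.span ℂ (Set.range u₂))
    (m' : ℕ) (hm : m₁ = m' + 1) (A : Fin m' → Idx ζ) (K : Fin (m₂ + 1) → Idx ζ) :
    ∑ l : Fin (m₂ + 1), (-1 : ℂ) ^ (l : ℕ) *
      plk ω₁ (Fin.snoc (α := fun _ => Idx ζ) A (prime i (K l)) ∘ Fin.cast hm) *
      plk ω₂ (K ∘ l.succAbove) = 0 := by
  simp only [plk_snoc]
  simp only [plk_eq_altForm]
  subst hm
  obtain ⟨z, hz, hzA⟩ := exists_contraction u₁ fun a => coordFn ζ 0 M (A a)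
  have h3 := DFunLike.congr_fun (wedgeForm_eq_zero_of_mem (h z hz)) fun l => coordFn ζ 0 M (K l)
  rw [wedgeForm_apply, AlternatingMap.zero_apply] at h3
  simp only [h₁, h₂, map_smul, AlternatingMap.smul_apply, smul_eq_mul, Fin.cast_refl,
    Function.comp_id, hzA, coordFn_prime, LinearMap.comp_apply]
  refine (Eq.trans ?_ (congrArg (fun x => c₁ * c₂ * x) h3)).trans (mul_zero _)
  simp only [Finset.mul_sum]
  exact Finset.sum_congr rfl fun l _ => by simp only [Function.comp_def]; ring

/-- Conversely, the equations (c) for one arrow say that the arrow maps the vectors `slot φ b ω₁`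
into the subspace of `ω₂`. -/
theorem wedgeForm_slot_eq_zero {m₁ m₂ : ℕ} {ω₁ : ⋀[ℂ]^m₁ (J ζ 0 M)} {ω₂ : ⋀[ℂ]^m₂ (J ζ 0 M)}
    (hV : VanishingEqs ω₁) (i : Fin n)
    (h : ∀ (m' : ℕ) (hm : m₁ = m' + 1) (A : Fin m' → Idx ζ) (K : Fin (m₂ + 1) → Idx ζ),
      (∀ a, (A a).2 < m₁) → ∑ l : Fin (m₂ + 1), (-1 : ℂ) ^ (l : ℕ) *
        plk ω₁ (Fin.snoc (α := fun _ => Idx ζ) A (prime i (K l)) ∘ Fin.cast hm) *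
        plk ω₂ (K ∘ l.succAbove) = 0)
    (K : Fin m₁ → Comp ζ × Fin M) (b : Fin m₁) :
    wedgeForm (altForm m₂ ω₂)
      (diffOnJ ζ 0 M {i} (slot (dualBasisJ ζ 0 M ∘ K) b ω₁)) = 0 := by
  obtain _ | m' := m₁
  · exact b.elim0
  -- for `A` with a large third entry, the first factor vanishes
  have h' : ∀ (A : Fin m' → Idx ζ) (B : Fin (m₂ + 1) → Idx ζ), ∑ l : Fin (m₂ + 1),
      (-1 : ℂ) ^ (l : ℕ) *
        plk ω₁ (Fin.snoc (α := fun _ => Idx ζ) A (prime i (B l)) ∘ Fin.cast rfl) *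
        plk ω₂ (B ∘ l.succAbove) = 0 := by
    intro A B
    by_cases hA : ∀ a, (A a).2 < m' + 1
    · exact h m' rfl A B hA
    · push Not at hA
      obtain ⟨a, ha⟩ := hA
      refine Finset.sum_eq_zero fun l _ => ?_
      rw [hV.eq_zero_of_le _ a.castSucc (by simpa using ha)]
      simp
  refine Basis.ext_alternating (dualBasisJ ζ 0 M) fun B _ => ?_
  have h1 := h' (b.removeNth fun a => toIdx (K a)) fun l => toIdx (B l)
  rw [wedgeForm_apply, AlternatingMap.zero_apply]
  refine (Eq.trans ?_ (congrArg (fun x => (-1) ^ (b : ℕ) * (-1) ^ m' * x) h1)).trans (mul_zero _)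
  simp only [Finset.mul_sum]
  refine Finset.sum_congr rfl fun l _ => ?_
  rw [dualBasisJ_apply, ← LinearMap.comp_apply, ← coordFn_prime, apply_slot,
    map_update_eq_snoc, plk_snoc, plk_eq_altForm]
  have h2 : b.removeNth (dualBasisJ ζ 0 M ∘ K) = fun a =>
      coordFn ζ 0 M (b.removeNth (fun a => toIdx (K a)) a) := by
    funext a; exact dualBasisJ_apply _
  have h3 : (fun l => dualBasisJ ζ 0 M (B l)) ∘ l.succAbove = fun a =>
      coordFn ζ 0 M (((fun l => toIdx (B l)) ∘ l.succAbove) a) := by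
    funext a; exact dualBasisJ_apply _
  rw [h2, h3]
  simp only [Fin.cast_refl, Function.comp_id]
  ring

end Coordinates

/-! ### Paths in the cyclic quiver -/

section Paths

variable {n : ℕ} {ζ : Fin n → ℕ} {lam : ℂ} {M : ℕ}

theorem diffOnJ_insert {i : Fin n} {S : Finset (Fin n)} (hi : i ∉ S) (g : J ζ lam M) :
    diffOnJ ζ lam M {i} (diffOnJ ζ lam M S g) = diffOnJ ζ lam M (insert i S) g := by
  refine J_ext fun c => ?_
  rw [comp_diffOnJ, comp_diffOnJ, comp_diffOnJ]
  by_cases h : c.1 = i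
  · simp [h, hi]
  · simp [h]

theorem diffOnJ_empty (g : J ζ lam M) : diffOnJ ζ lam M ∅ g = g :=
  J_ext fun c => by rw [comp_diffOnJ]; simp

theorem diffOnJ_univ (g : J ζ lam M) :
    diffOnJ ζ lam M Finset.univ g = shift ζ lam M g + lam • g := by
  simp [shift]

/-- On solutions of `(d/dt - lam)^M g = 0` with `lam ≠ 0`, differentiation is injective. -/
theorem diffOnJ_injective (hlam : lam ≠ 0) (S : Finset (Fin n)) :
    Function.Injective (diffOnJ ζ lam M S) := by
  refine (injective_iff_map_eq_zero _).2 fun g hg => J_ext fun c => ?_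
  have h1 := comp_diffOnJ S g c
  have h2 : comp ζ c (0 : J ζ lam M).1 = 0 := map_zero _
  rw [hg, h2] at h1
  rw [h2]
  split_ifs at h1
  · have h3 := comp_shift_pow M g c
    rw [shift_pow_eq_zero] at h3
    have h4 : ∀ k, ((D - lam • (1 : End ℂ Entire)) ^ k) (comp ζ c g.1) =
        (-lam) ^ k • comp ζ c g.1 := fun k => by
      induction k with
      | zero => simp
      | succ k ih =>
        rw [pow_succ', End.mul_apply, ih, map_smul, LinearMap.sub_apply, ← h1,
          LinearMap.smul_apply, End.one_apply, zero_sub, ← neg_smul, smul_smul, pow_succ]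
    rw [h4] at h3
    exact (smul_eq_zero.1 (h3.symm.trans h2)).resolve_left (pow_ne_zero _ (neg_ne_zero.2 hlam))
  · exact h1.symm

variable [NeZero n]

theorem eq_apply_zero_of_forall_succ {X : Type*} {f : Fin n → X}
    (h : ∀ i, i + 1 ≠ 0 → f i = f (i + 1)) (i : Fin n) : f i = f 0 := by
  obtain _ | k := n
  · exact i.elim0
  induction i using Fin.induction with
  | zero => rfl
  | succ i ih =>
    rw [← ih, h i.castSucc (by rw [Fin.coeSucc_eq_succ]; exact i.succ_ne_zero),
      Fin.coeSucc_eq_succ]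

/-- A function increasing around a cycle is constant: compare the sums of both sides. -/
theorem eq_succ_of_forall_le {f : Fin n → ℕ} (h : ∀ i, f i ≤ f (i + 1)) (i : Fin n) :
    f i = f (i + 1) := by
  have h1 : ∑ i, f i = ∑ i, f (i + 1) := (Equiv.sum_comp (Equiv.addRight 1) f).symm
  exact (Finset.sum_eq_sum_iff_of_le fun i _ => h i).1 h1 i (Finset.mem_univ i)

/-- If the arrows preserve a tuple of subspaces, then so does the path once around the quiver. -/
theorem diffOnJ_univ_mem {U : Fin n → Submodule ℂ (J ζ lam M)}
    (h : ∀ i, ∀ x ∈ U i, diffOnJ ζ lam M {i} x ∈ U (i + 1)) (i : Fin n) :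
    ∀ x ∈ U i, diffOnJ ζ lam M Finset.univ x ∈ U i := by
  intro x hx
  -- a path of length `k` starting at `i` differentiates at the vertices `i, …, i + k - 1`
  have key : ∀ k ≤ n, diffOnJ ζ lam M
      ((Finset.range k).image fun j => i + Fin.ofNat n j) x ∈ U (i + Fin.ofNat n k) := by
    intro k
    induction k with
    | zero =>
      intro _
      rw [Finset.range_zero, Finset.image_empty, diffOnJ_empty]
      simpa using hx
    | succ k ih =>
      intro hk
      have h1 := h _ _ (ih (by omega))
      rw [diffOnJ_insert, ← Finset.image_insert (fun j => i + Fin.ofNat n j),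
        ← Finset.range_add_one] at h1
      · have h2 : i + Fin.ofNat n k + 1 = i + Fin.ofNat n (k + 1) := by
          rw [add_assoc]
          congr 1
          ext
          simp [Fin.val_add]
        rwa [h2] at h1
      · intro hmem
        obtain ⟨j, hj, hjk⟩ := Finset.mem_image.1 hmem
        have h2 := congrArg Fin.val (add_left_cancel hjk)
        have h3 := Finset.mem_range.1 hj
        rw [Fin.val_ofNat, Fin.val_ofNat, Nat.mod_eq_of_lt (by omega),
          Nat.mod_eq_of_lt (by omega)] at h2
        omega
  have h1 := key n le_rfl
  have h2 : (Finset.range n).image (fun j => i + Fin.ofNat n j) = Finset.univ := by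
    refine Finset.eq_univ_of_forall fun q => Finset.mem_image.2
      ⟨(q - i).val, Finset.mem_range.2 (q - i).2, ?_⟩
    rw [Fin.ofNat_val_eq_self]
    exact add_sub_cancel i q
  have h3 : i + Fin.ofNat n n = i := by
    have : Fin.ofNat n n = 0 := by ext; simp
    rw [this, add_zero]
  rwa [h2, h3] at h1

/-- The paths starting at `0`, one arrow at a time: the last arrow closes the cycle. -/
theorem arrow_path (i : Fin n) (g : J ζ lam M) :
    diffOnJ ζ lam M {i} (diffOnJ ζ lam M (Finset.univ.filter fun q => q < i) g) =
      if i + 1 = 0 then diffOnJ ζ lam M Finset.univ g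
      else diffOnJ ζ lam M (Finset.univ.filter fun q => q < i + 1) g := by
  rw [diffOnJ_insert (by simp)]
  obtain _ | k := n
  · exact i.elim0
  have h0 : i + 1 = 0 ↔ i = Fin.last k := by
    constructor
    · intro h
      exact add_right_cancel (h.trans (Fin.last_add_one k).symm)
    · rintro rfl
      exact Fin.last_add_one k
  split_ifs with h
  · rw [h0] at h
    subst h
    congr 2
    refine Finset.eq_univ_of_forall fun q => ?_
    simpa [← le_iff_eq_or_lt] using Fin.le_last q
  · rw [h0] at h
    congr 2
    ext q
    have h1 : (i + 1 : Fin (k + 1)).val = i.val + 1 :=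
      Fin.val_add_one_of_lt (Fin.lt_last_iff_ne_last.2 h)
    simp only [Finset.mem_insert, Finset.mem_filter, Finset.mem_univ, true_and, Fin.ext_iff,
      Fin.lt_def, h1]
    omega

end Paths

/-! ### The equations for Plücker points -/

section Equations

variable {n : ℕ} {ζ : Fin n → ℕ} {lam : ℂ} {M m m' : ℕ}

theorem plk_mul_comm_of_isPluckerPoint (h : m = m') {P : ℙ ℂ (⋀[ℂ]^m (J ζ lam M))}
    {P' : ℙ ℂ (⋀[ℂ]^m' (J ζ lam M))} {W : Submodule ℂ (J ζ lam M)} (hW : finrank ℂ W = m)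
    (hP : IsPluckerPoint P W) (hP' : IsPluckerPoint P' W) (A K : Fin m → Idx ζ) :
    plk P.rep A * plk P'.rep (K ∘ Fin.cast h.symm) =
      plk P.rep K * plk P'.rep (A ∘ Fin.cast h.symm) := by
  subst h
  rw [hP.unique hW hP']
  exact mul_comm _ _

/-- Vectors with proportional coordinates define the same subspace. -/
theorem subspace_eq_of_plk_mul_comm (h : m = m') {P : ℙ ℂ (⋀[ℂ]^m (J ζ lam M))}
    {P' : ℙ ℂ (⋀[ℂ]^m' (J ζ lam M))} {W W' : Submodule ℂ (J ζ lam M)} (hW : finrank ℂ W = m)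
    (hW' : finrank ℂ W' = m') (hP : IsPluckerPoint P W) (hP' : IsPluckerPoint P' W')
    (H : ∀ A K : Fin m → Idx ζ, plk P.rep A * plk P'.rep (K ∘ Fin.cast h.symm) =
      plk P.rep K * plk P'.rep (A ∘ Fin.cast h.symm)) : W = W' := by
  subst h
  obtain ⟨A, hA⟩ := exists_basis_ne_zero (dualBasisJ ζ lam M) (P := altForm m P.rep)
    fun h0 => P.rep_nonzero (altForm_injective (h0.trans (map_zero _).symm))
  have h1 : altForm m P.rep (dualBasisJ ζ lam M ∘ A) • P'.rep =
      altForm m P'.rep (dualBasisJ ζ lam M ∘ A) • P.rep := by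
    apply altForm_injective
    refine Basis.ext_alternating (dualBasisJ ζ lam M) fun K _ => ?_
    have h2 := H (fun a => toIdx (A a)) (fun a => toIdx (K a))
    rw [Fin.cast_refl, Function.comp_id, Function.comp_id] at h2
    simp only [plk_toIdx] at h2
    rw [map_smul, map_smul, AlternatingMap.smul_apply, AlternatingMap.smul_apply, smul_eq_mul,
      smul_eq_mul, mul_comm (altForm m P'.rep _)]
    exact h2
  have h3 : P' = P := by
    rw [← P.mk_rep, ← P'.mk_rep, Projectivization.mk_eq_mk_iff']
    refine ⟨(altForm m P.rep (dualBasisJ ζ lam M ∘ A))⁻¹ *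
      altForm m P'.rep (dualBasisJ ζ lam M ∘ A), ?_⟩
    rw [mul_smul, ← h1, inv_smul_smul₀ hA]
  subst h3
  exact hP.subspace_unique hW hW' hP'


theorem eqs_of_isPluckerPoint {M m : ℕ} {P : ℙ ℂ (⋀[ℂ]^m (J ζ lam M))}
    {W : Submodule ℂ (J ζ lam M)} (hW : finrank ℂ W = m) (hP : IsPluckerPoint P W)
    (h : ∀ x ∈ W, shift ζ lam M x ∈ W) :
    PluckerEqs P.rep ∧ VanishingEqs P.rep ∧ ShiftEqs P.rep := by
  obtain ⟨e, he, hs⟩ := exists_basis_of_finrank hW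
  obtain ⟨c, -, hc⟩ := hP.exists_rep_eq_smul he hs
  exact eqs_of_invariant hc he fun a => by rw [hs]; exact h _ (e a).2

theorem shift_mem_of_isPluckerPoint {M m : ℕ} {P : ℙ ℂ (⋀[ℂ]^m (J ζ lam M))}
    {W : Submodule ℂ (J ζ lam M)} (hW : finrank ℂ W = m) (hP : IsPluckerPoint P W)
    (h : ShiftEqs P.rep) : ∀ x ∈ W, shift ζ lam M x ∈ W := by
  obtain ⟨e, he, hs⟩ := exists_basis_of_finrank hW
  obtain ⟨c, hc0, hc⟩ := hP.exists_rep_eq_smul he hs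
  have h1 := h.invariant hc0 hc he
  rwa [hs] at h1

theorem exists_subspace_of_pluckerEqs {M m : ℕ} {P : ℙ ℂ (⋀[ℂ]^m (J ζ lam M))}
    (h : PluckerEqs P.rep) :
    ∃ W : Submodule ℂ (J ζ lam M), finrank ℂ W = m ∧ IsPluckerPoint P W := by
  obtain ⟨K, hli, hP⟩ := h.exists_slot
  exact ⟨_, by simpa using finrank_span_eq_card hli, hP⟩

end Equations

/-! ### The quiver Grassmannian -/

section Grassmannian

variable {n : ℕ} [NeZero n] {ζ α : Fin n → ℕ} {lam : ℂ}

theorem Grass.arrow_mem {U : Fin n → Submodule ℂ (JMod ζ α lam)} (hU : U ∈ Grass ζ α lam)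
    (i : Fin n) : ∀ x ∈ U i, diffOnJ ζ lam _ {i} x ∈ U (i + 1) :=
  fun _ hx => hU.2 i (Submodule.mem_map_of_mem hx)

theorem Grass.shift_mem {U : Fin n → Submodule ℂ (JMod ζ α lam)} (hU : U ∈ Grass ζ α lam)
    (i : Fin n) : ∀ x ∈ U i, shift ζ lam _ x ∈ U i := by
  intro x hx
  have h1 := diffOnJ_univ_mem (Grass.arrow_mem hU) i x hx
  rw [diffOnJ_univ] at h1
  exact (Submodule.add_mem_iff_left _ (Submodule.smul_mem _ _ hx)).1 h1

/-- For `lam ≠ 0` the arrows are injective, so that the dimensions can only increase along the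
cycle; hence they are equal and the arrows map `U_i` onto `U_{i+1}`. -/
theorem Grass.map_arrow_eq (hlam : lam ≠ 0) {U : Fin n → Submodule ℂ (JMod ζ α lam)}
    (hU : U ∈ Grass ζ α lam) :
    (∀ i, α i = α (i + 1)) ∧ ∀ i, (U i).map (arrow ζ α lam i) = U (i + 1) := by
  have h1 : ∀ i, finrank ℂ ((U i).map (arrow ζ α lam i)) = α i := fun i => by
    rw [← hU.1 i]
    exact (Submodule.equivMapOfInjective _ (diffOnJ_injective hlam {i}) (U i)).finrank_eq.symm
  have h2 : ∀ i, α i = α (i + 1) := eq_succ_of_forall_le fun i => by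
    rw [← h1 i, ← hU.1 (i + 1)]
    exact Submodule.finrank_mono (hU.2 i)
  exact ⟨h2, fun i => Submodule.eq_of_le_of_finrank_eq (hU.2 i) (by rw [h1, hU.1, h2])⟩

theorem pathFromZero_zero : pathFromZero ζ α lam 0 = LinearMap.id := by
  refine LinearMap.ext fun g => ?_
  rw [pathFromZero]
  have : (Finset.univ.filter fun q : Fin n => q < 0) = ∅ := by
    ext q; simp
  rw [this]
  exact diffOnJ_empty g

/-- For `lam ≠ 0` all the pulled back subspaces agree. -/
theorem Grass.comap_path_eq (hlam : lam ≠ 0) {U : Fin n → Submodule ℂ (JMod ζ α lam)}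
    (hU : U ∈ Grass ζ α lam) (i : Fin n) : (U i).comap (pathFromZero ζ α lam i) = U 0 := by
  have h0 : (U 0).comap (pathFromZero ζ α lam 0) = U 0 := by
    rw [pathFromZero_zero, Submodule.comap_id]
  rw [← h0]
  refine eq_apply_zero_of_forall_succ (f := fun i => (U i).comap (pathFromZero ζ α lam i))
    (fun i hi => ?_) i
  ext x
  change _ ∈ U i ↔ _ ∈ U (i + 1)
  rw [← (Grass.map_arrow_eq hlam hU).2 i]
  have h1 : ∀ y, arrow ζ α lam i y ∈ (U i).map (arrow ζ α lam i) ↔ y ∈ U i := fun y =>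
    (diffOnJ_injective hlam {i}).mem_set_image
  rw [← h1]
  have h2 := arrow_path (ζ := ζ) (lam := lam) (M := Finset.univ.sup α) i x
  rw [if_neg hi] at h2
  change arrow ζ α lam i (pathFromZero ζ α lam i x) = _ at h2
  rw [h2]
  rfl

/-- Conversely, a subspace `W` invariant under `d/dt` gives a point of the Grassmannian. -/
theorem mem_Grass_of_comap_path_eq (hlam : lam ≠ 0) {U : Fin n → Submodule ℂ (JMod ζ α lam)}
    (hr : ∀ i, finrank ℂ (U i) = α i) {W : Submodule ℂ (JMod ζ α lam)}
    (hW : ∀ x ∈ W, shift ζ lam _ x ∈ W) (h : ∀ i, (U i).comap (pathFromZero ζ α lam i) = W) :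
    U ∈ Grass ζ α lam := by
  have hmem : ∀ i x, pathFromZero ζ α lam i x ∈ U i ↔ x ∈ W := fun i x => by
    rw [← h i, Submodule.mem_comap]
  refine ⟨hr, fun i => ?_⟩
  rintro _ ⟨y, hy, rfl⟩
  obtain ⟨x, rfl⟩ := LinearMap.surjective_of_injective (f := pathFromZero ζ α lam i)
    (diffOnJ_injective hlam _) y
  have hx := (hmem i x).1 hy
  have h2 := arrow_path (ζ := ζ) (lam := lam) (M := Finset.univ.sup α) i x
  change arrow ζ α lam i (pathFromZero ζ α lam i x) = _ at h2
  rw [h2]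
  split_ifs with hi
  · rw [diffOnJ_univ, hi, ← LinearMap.id_apply (R := ℂ) (_ + _), ← pathFromZero_zero, hmem]
    exact W.add_mem (hW x hx) (W.smul_mem _ hx)
  · exact (hmem (i + 1) x).2 hx

end Grassmannian

end CyclicQuiver

end

theorem theorem6 (n : ℕ) [NeZero n] (ζ α : Fin n → ℕ) (lam : ℂ) :
    -- nonzero eigenvalue, constant dimension vector: equations (a) and (b)
    (lam ≠ 0 → ∀ hα : (∀ i, α i = α (i + 1)),
      ∃ e : CyclicQuiver.Grass ζ α lam ≃ CyclicQuiver.varAB ζ α lam hα,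
        CyclicQuiver.IsVarietyIso
          (CyclicQuiver.framesMap α (CyclicQuiver.Grass ζ α lam))
          (CyclicQuiver.projConeMap (CyclicQuiver.varAB ζ α lam hα)) e ∧
        ∀ (U : CyclicQuiver.Grass ζ α lam) (i : Fin n),
          CyclicQuiver.IsPluckerPoint ((e U).1 i)
            ((U.1 i).comap (CyclicQuiver.pathFromZero ζ α lam i))) ∧
    -- nonzero eigenvalue, other dimension vectors: the Grassmannian is empty
    (lam ≠ 0 → (¬ ∀ i, α i = α (i + 1)) → CyclicQuiver.Grass ζ α lam = ∅) ∧
    -- zero eigenvalue: equations (a) and (c)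
    (lam = 0 →
      ∃ e : CyclicQuiver.Grass ζ α lam ≃ CyclicQuiver.varAC ζ α lam,
        CyclicQuiver.IsVarietyIso
          (CyclicQuiver.framesMap α (CyclicQuiver.Grass ζ α lam))
          (CyclicQuiver.projConeMap (CyclicQuiver.varAC ζ α lam)) e ∧
        ∀ (U : CyclicQuiver.Grass ζ α lam) (i : Fin n),
          CyclicQuiver.IsPluckerPoint ((e U).1 i) (U.1 i)) := by
  open CyclicQuiver Module in
  refine ⟨fun hlam hα => ?_, fun hlam hα => ?_, ?_⟩
  · let g : Fin n → JMod ζ α lam ≃ₗ[ℂ] JMod ζ α lam := fun i =>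
      LinearEquiv.ofInjectiveEndo (pathFromZero ζ α lam i) (diffOnJ_injective hlam _)
    have hg : ∀ i, (g i : JMod ζ α lam →ₗ[ℂ] JMod ζ α lam) = pathFromZero ζ α lam i :=
      fun i => LinearMap.ext fun x => rfl
    have hα0 : ∀ i, α i = α 0 := eq_apply_zero_of_forall_succ fun i _ => hα i
    have hmain := exists_isVarietyIso α g (Grass ζ α lam) (varAB ζ α lam hα)
      (fun U hU i => hU.1 i) ?_ (fun P hP i => exists_subspace_of_pluckerEqs (hP.1 i).1) ?_
    · simpa only [hg] using hmain
    · intro U hU P hP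
      have hP0 : ∀ i, IsPluckerPoint (P i) (U 0) := fun i => by
        rw [← Grass.comap_path_eq hlam hU i, ← hg]
        exact hP i
      have hr : ∀ i, finrank ℂ (U 0) = α i := fun i => by rw [hU.1, hα0 i]
      exact ⟨fun i => eqs_of_isPluckerPoint (hr i) (hP0 i) (Grass.shift_mem hU 0),
        fun i A K => plk_mul_comm_of_isPluckerPoint (hα i) (hr i) (hP0 i) (hP0 (i + 1)) A K⟩
    · intro P hP U hr hPU
      simp only [hg] at hPU
      have hrc : ∀ i, finrank ℂ ((U i).comap (pathFromZero ζ α lam i)) = α i := fun i => by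
        rw [← hr i, ← hg, Submodule.comap_equiv_eq_map_symm]
        exact LinearEquiv.finrank_map_eq (g i).symm (U i)
      refine mem_Grass_of_comap_path_eq hlam hr
        (shift_mem_of_isPluckerPoint (hrc 0) (hPU 0) (hP.1 0).2.2)
        (eq_apply_zero_of_forall_succ fun i _ => ?_)
      exact subspace_eq_of_plk_mul_comm (hα i) (hrc i) (hrc (i + 1)) (hPU i) (hPU (i + 1)) (hP.2 i)
  · exact Set.eq_empty_of_forall_notMem fun U hU => hα (Grass.map_arrow_eq hlam hU).1
  · rintro rfl
    refine exists_isVarietyIso α (fun _ => LinearEquiv.refl ℂ _) (Grass ζ α 0) (varAC ζ α 0)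
      (fun U hU i => hU.1 i) ?_ (fun P hP i => exists_subspace_of_pluckerEqs (hP.1 i).1) ?_
    · intro U hU P hP
      change ∀ i, IsPluckerPoint (P i) (U i) at hP
      refine ⟨fun i => eqs_of_isPluckerPoint (hU.1 i) (hP i) (Grass.shift_mem hU i),
        fun i m' hm A K _ => ?_⟩
      obtain ⟨e, he, hs⟩ := exists_basis_of_finrank (hU.1 i)
      obtain ⟨c, -, hc⟩ := (hP i).exists_rep_eq_smul he hs
      obtain ⟨e', he', hs'⟩ := exists_basis_of_finrank (hU.1 (i + 1))
      obtain ⟨c', -, hc'⟩ := (hP (i + 1)).exists_rep_eq_smul he' hs'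
      refine incidence_of_map_mem hc hc' i ?_ m' hm A K
      rw [hs, hs']
      exact Grass.arrow_mem hU i
    · intro P hP U hr hPU
      change ∀ i, IsPluckerPoint (P i) (U i) at hPU
      refine ⟨hr, fun i => ?_⟩
      obtain ⟨K, hli, hK⟩ := (hP.1 i).1.exists_slot
      rw [(hPU i).subspace_unique (hr i) (by simpa using finrank_span_eq_card hli) hK,
        Submodule.map_span, Submodule.span_le]
      rintro _ ⟨_, ⟨b, rfl⟩, rfl⟩
      exact ((hPU (i + 1)).mem_iff (hr (i + 1)) _).2
        (wedgeForm_slot_eq_zero (hP.1 i).2.1 i (hP.2 i) K b)
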